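/- Let $n\ge 2$, $s\in(0,1)$, $\frac{2n}{n+2s}\le p<2$, and let $\Omega\subset\mathbb{R}^n$ be a bounded domain. There is a constant $C=C(\Omega,n,p,s)>0$ with the following property. Let $\Omega'\subset\mathbb{R}^n$ be a bounded open set with $\overline\Omega\subset\Omega'$, write $p'=\frac{p}{p-1}$, $J_p(\tau)=|\tau|^{p-2}\tau$, $d\mu=|x-y|^{-n-sp}\,dx\,dy$, and $$X_0^{s,p}(\Omega,\Omega')=\Big\{g\in W^{s,p}(\Omega')\,:\ \int_{\mathbb{R}^n}\frac{|g|^{p-1}}{1+|x|^{n+sp}}\,dx<\infty,\ g=0 \text{ a.e. on } \mathbb{R}^n\setminus\Omega\Big\},$$ with the norm of $W^{s,p}(\Omega')$, where $\|g\|_{W^{s,p}(A)}^p=[g]_{W^{s,p}(A)}^p+\|g\|_{L^p(A)}^p$ and $[g]_{W^{s,p}(A)}^p=\iint_{A\times A}|g(x)-g(y)|^p\,d\mu$. Let $f\in L^{p'}_{\rm loc}((0,\infty);(X_0^{s,p}(\Omega,\Omega'))^*)$ and let $u,v$ be weak solutions of $$u_t+(-\Delta_p)^su=f\quad\text{in }\Omega\times(0,\infty).$$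 Here $u$ is a weak solution if for every $J=[T_0,T_1]\subset(0,\infty)$ one has $u\in L^p(J;W^{s,p}(\Omega'))\cap C(J;L^2(\Omega))$, $\int_J\int_{\mathbb{R}^n}\frac{|u(x,t)|^{p-1}}{1+|x|^{n+sp}}\,dx\,dt<\infty$, and $$-\int_J\!\int_\Omega u\,\partial_t\phi\,dx\,dt+\int_J\!\iint_{\mathbb{R}^n\times\mathbb{R}^n}J_p(u(x,t)-u(y,t))(\phi(x,t)-\phi(y,t))\,d\mu\,dt=\int_\Omega u(x,T_0)\phi(x,T_0)\,dx-\int_\Omega u(x,T_1)\phi(x,T_1)\,dx+\int_J\langle f,\phi\rangle\,dt$$ for all $\phi\in L^p(J;X_0^{s,p}(\Omega,\Omega'))\cap C^1(J;L^2(\Omega))$. Assume moreover that $u,v\in L^\infty_{\rm loc}((0,\infty);W^{s,p}(\mathbb{R}^n))$ and $w=u-v\in L^p_{\rm loc}((0,\infty);W_0^{s,p}(\Omega))$, where $W^{s,p}_0(\Omega)$ is the closure of $C_0^\infty(\Omega)$ in $W^{s,p}(\mathbb{R}^n)$. For $m\ge2$ put $I_m(t)=\int_\Omega|w(x,t)|^m\,dx\in[0,\infty]$.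 Then, for all $m\ge 2$ and all $t_2\ge t_1>0$, $$I_m(t_2)\le I_m(t_1)\,e^{-\frac{CL(m-1)}{m}(t_2-t_1)},\qquad L=\Big[\sup_{t_1\le\tau\le t_2}\big([v(\cdot,\tau)]_{W^{s,p}(\mathbb{R}^n)}+[u(\cdot,\tau)]_{W^{s,p}(\mathbb{R}^n)}\big)\Big]^{p-2}.$$ The supremum is the essential supremum in $\tau$; if it is $0$, then $L=+\infty$, with $e^{-\infty}=0$ and $\infty\cdot 0=0$ in the exponent when $t_2=t_1$ (and likewise $\infty\cdot 0=0$ for the product on the right-hand side). -/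

import Mathlib

open MeasureTheory Set
open scoped ENNReal NNReal ContDiff

noncomputable section

namespace FracPLap

/-- Euclidean space `ℝⁿ`. -/
abbrev Rn (n : ℕ) := EuclideanSpace ℝ (Fin n)

/-- `J_p(t) = |t|^(p-2) t`. -/
def Jp (p t : ℝ) : ℝ := |t| ^ (p - 2) * t

/-- The measure `dμ = |x-y|^(-n-sp) dx dy` on `ℝⁿ × ℝⁿ`. The value of the density on the diagonal
is irrelevant, since the diagonal is a Lebesgue null set for `n ≥ 1`. -/
def dmu (n : ℕ) (s p : ℝ) : Measure (Rn n × Rn n) :=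
  (volume : Measure (Rn n × Rn n)).withDensity
    (fun z => ENNReal.ofReal (‖z.1 - z.2‖ ^ (-((n : ℝ) + s * p))))

/-- The Sobolev-Slobodeckii seminorm `[g]_{W^{s,p}(A)}`, with values in `[0,∞]`. -/
def wspSeminorm {n : ℕ} (s p : ℝ) (A : Set (Rn n)) (g : Rn n → ℝ) : ℝ≥0∞ :=
  (∫⁻ z in A ×ˢ A, ‖g z.1 - g z.2‖ₑ ^ p ∂(dmu n s p)) ^ (1 / p)

/-- The norm of `W^{s,p}(A)`: `‖g‖^p = [g]^p + ‖g‖_{L^p(A)}^p`, with values in `[0,∞]`. -/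
def wspNorm {n : ℕ} (s p : ℝ) (A : Set (Rn n)) (g : Rn n → ℝ) : ℝ≥0∞ :=
  (wspSeminorm s p A g ^ p + ∫⁻ x in A, ‖g x‖ₑ ^ p) ^ (1 / p)

/-- The fractional Sobolev space `W^{s,p}(A)`. -/
def Wsp {n : ℕ} (s p : ℝ) (A : Set (Rn n)) : Set (Rn n → ℝ) :=
  {g | AEStronglyMeasurable g (volume.restrict A) ∧ wspNorm s p A g < ⊤}

/-- `W₀^{s,p}(Ω)`: the closure of `C_0^∞(Ω)` in the norm of `W^{s,p}(ℝⁿ)`. -/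
def Wsp0 {n : ℕ} (s p : ℝ) (Ω : Set (Rn n)) : Set (Rn n → ℝ) :=
  {g | g ∈ Wsp s p univ ∧ ∀ ε : ℝ≥0∞, 0 < ε → ∃ ψ : Rn n → ℝ,
    ContDiff ℝ ∞ ψ ∧ HasCompactSupport ψ ∧ tsupport ψ ⊆ Ω ∧
      wspNorm s p univ (fun x => g x - ψ x) < ε}

/-- The (quasi-)norm of the tail space `L^q_α(ℝⁿ)`. -/
def tailNorm {n : ℕ} (q α : ℝ) (g : Rn n → ℝ) : ℝ≥0∞ :=
  (∫⁻ x, ‖g x‖ₑ ^ q / ENNReal.ofReal (1 + ‖x‖ ^ ((n : ℝ) + α))) ^ (1 / q)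

/-- The tail space `L^q_α(ℝⁿ)`. (Finiteness of the weighted integral entails `g ∈ L^q_loc`,
because the weight is bounded below by a positive constant on bounded sets.) -/
def Tail {n : ℕ} (q α : ℝ) : Set (Rn n → ℝ) :=
  {g | AEStronglyMeasurable g volume ∧ tailNorm q α g < ⊤}

/-- `X₀^{s,p}(Ω,Ω')`: functions in `W^{s,p}(Ω') ∩ L^{p-1}_{sp}(ℝⁿ)` vanishing (almost everywhere)
outside `Ω`. It carries the norm of `W^{s,p}(Ω')`. -/
def X0 {n : ℕ} (s p : ℝ) (Ω Ω' : Set (Rn n)) : Set (Rn n → ℝ) :=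
  {g | g ∈ Wsp s p Ω' ∧ g ∈ Tail (p - 1) (s * p) ∧ ∀ᵐ x, x ∉ Ω → g x = 0}

/-- The dual norm on `(X₀^{s,p}(Ω,Ω'))^*`. -/
def dualNorm {n : ℕ} (s p : ℝ) (Ω Ω' : Set (Rn n)) (F : (Rn n → ℝ) → ℝ) : ℝ≥0∞ :=
  ⨆ g ∈ X0 s p Ω Ω', ⨆ (_ : wspNorm s p Ω' g ≤ 1), ‖F g‖ₑ

/-- The dual space `(X₀^{s,p}(Ω,Ω'))^*`: the functionals that are linear and bounded on
`X₀^{s,p}(Ω,Ω')`; their values on other functions play no role. -/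
def X0Dual {n : ℕ} (s p : ℝ) (Ω Ω' : Set (Rn n)) : Set ((Rn n → ℝ) → ℝ) :=
  {F | (∀ g ∈ X0 s p Ω Ω', ∀ h ∈ X0 s p Ω Ω', F (g + h) = F g + F h) ∧
    (∀ (c : ℝ), ∀ g ∈ X0 s p Ω Ω', F (c • g) = c * F g) ∧
    dualNorm s p Ω Ω' F < ⊤}

/-- `u ∈ L^q(J;V)` for `q < ∞`, where `V` is a separable space of functions on `ℝⁿ` with norm `N`,
considered modulo equality almost everywhere for `ν`. Strong measurability of `t ↦ u(t) ∈ V` is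
expressed by joint measurability of `(t,x) ↦ u(t,x)`. -/
def MemLpTime {n : ℕ} (q : ℝ) (J : Set ℝ) (ν : Measure (Rn n)) (V : Set (Rn n → ℝ))
    (N : (Rn n → ℝ) → ℝ≥0∞) (u : ℝ → Rn n → ℝ) : Prop :=
  AEStronglyMeasurable (Function.uncurry u) ((volume.restrict J).prod ν) ∧
    (∀ᵐ t ∂(volume.restrict J), u t ∈ V) ∧ ∫⁻ t in J, N (u t) ^ q < ⊤

/-- `u ∈ L^∞(J;V)`, with the same conventions. -/
def MemLinftyTime {n : ℕ} (J : Set ℝ) (ν : Measure (Rn n)) (V : Set (Rn n → ℝ))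
    (N : (Rn n → ℝ) → ℝ≥0∞) (u : ℝ → Rn n → ℝ) : Prop :=
  AEStronglyMeasurable (Function.uncurry u) ((volume.restrict J).prod ν) ∧
    (∀ᵐ t ∂(volume.restrict J), u t ∈ V) ∧ essSup (fun t => N (u t)) (volume.restrict J) < ⊤

/-- `f ∈ L^q(J;(X₀^{s,p}(Ω,Ω'))^*)`. As `X₀^{s,p}(Ω,Ω')` is separable and reflexive, strong
measurability of `t ↦ f(t)` is the measurability of `t ↦ ⟨f(t),g⟩` for each `g`. -/
def MemLpTimeDual {n : ℕ} (q s p : ℝ) (Ω Ω' : Set (Rn n)) (J : Set ℝ)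
    (f : ℝ → (Rn n → ℝ) → ℝ) : Prop :=
  (∀ g ∈ X0 s p Ω Ω', AEMeasurable (fun t => f t g) (volume.restrict J)) ∧
    (∀ᵐ t ∂(volume.restrict J), f t ∈ X0Dual s p Ω Ω') ∧
    ∫⁻ t in J, dualNorm s p Ω Ω' (f t) ^ q < ⊤

/-- The curve `U` in `L²(Ω)` is `t ↦ u(·,t)` for `t ∈ J`. -/
def RepresentsL2 {n : ℕ} (Ω : Set (Rn n)) (J : Set ℝ) (u : ℝ → Rn n → ℝ)
    (U : ℝ → Lp ℝ 2 (volume.restrict Ω)) : Prop :=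
  ∀ t ∈ J, (U t : Rn n → ℝ) =ᵐ[volume.restrict Ω] u t

/-- `φ ∈ L^p(J;X₀^{s,p}(Ω,Ω')) ∩ C¹(J;L²(Ω))`, where `Φ` is `φ` seen as a curve in `L²(Ω)`. -/
def IsTestFunction {n : ℕ} (s p : ℝ) (Ω Ω' : Set (Rn n)) (J : Set ℝ) (φ : ℝ → Rn n → ℝ)
    (Φ : ℝ → Lp ℝ 2 (volume.restrict Ω)) : Prop :=
  MemLpTime p J volume (X0 s p Ω Ω') (wspNorm s p Ω') φ ∧
    RepresentsL2 Ω J φ Φ ∧ ContDiffOn ℝ 1 Φ J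

/-- `u` is a weak solution of `∂ₜu + (-Δ_p)^s u = f` in `Ω × I`. -/
def IsWeakSolution {n : ℕ} (s p : ℝ) (Ω Ω' : Set (Rn n)) (I : Set ℝ)
    (f : ℝ → (Rn n → ℝ) → ℝ) (u : ℝ → Rn n → ℝ) : Prop :=
  ∀ T₀ T₁ : ℝ, T₀ < T₁ → Icc T₀ T₁ ⊆ I →
    MemLpTime p (Icc T₀ T₁) (volume.restrict Ω') (Wsp s p Ω') (wspNorm s p Ω') u ∧
    MemLpTime (p - 1) (Icc T₀ T₁) volume (Tail (p - 1) (s * p)) (tailNorm (p - 1) (s * p)) u ∧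
    (∃ U : ℝ → Lp ℝ 2 (volume.restrict Ω),
      RepresentsL2 Ω (Icc T₀ T₁) u U ∧ ContinuousOn U (Icc T₀ T₁)) ∧
    ∀ (φ : ℝ → Rn n → ℝ) (Φ : ℝ → Lp ℝ 2 (volume.restrict Ω)),
      IsTestFunction s p Ω Ω' (Icc T₀ T₁) φ Φ →
      -(∫ t in Icc T₀ T₁, ∫ x in Ω,
          u t x * (derivWithin Φ (Icc T₀ T₁) t : Lp ℝ 2 (volume.restrict Ω)) x)
        + ∫ t in Icc T₀ T₁, ∫ z : Rn n × Rn n,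
            Jp p (u t z.1 - u t z.2) * (φ t z.1 - φ t z.2) ∂(dmu n s p)
      = (∫ x in Ω, u T₀ x * φ T₀ x) - (∫ x in Ω, u T₁ x * φ T₁ x)
        + ∫ t in Icc T₀ T₁, f t (φ t)

/-- `I_m = ∫_Ω |w|^m dx` with values in `[0,∞]`. -/
def Im {n : ℕ} (Ω : Set (Rn n)) (m : ℝ) (w : Rn n → ℝ) : ℝ≥0∞ :=
  ∫⁻ x in Ω, ‖w x‖ₑ ^ m

/-- `L = [sup_{t₁≤τ≤t₂} ([v(·,τ)]_{W^{s,p}(ℝⁿ)} + [u(·,τ)]_{W^{s,p}(ℝⁿ)})]^(p-2)`, the supremum of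
these (classes of) functions of time being the essential one. For `p < 2` it is `∞` when the
supremum is `0`. -/
def decayL {n : ℕ} (s p : ℝ) (u v : ℝ → Rn n → ℝ) (t₁ t₂ : ℝ) : ℝ≥0∞ :=
  (essSup (fun τ => wspSeminorm s p univ (v τ) + wspSeminorm s p univ (u τ))
    (volume.restrict (Icc t₁ t₂))) ^ (p - 2)

end FracPLap

end

open FracPLap

/-!
The difference `w = u - v` of two solutions satisfies `w_t + (-Δ_p)^s u - (-Δ_p)^s v = 0`, and one
tests this with `g(w)`, where `g(w) = |w|^(m-2) w` up to a truncation. Put `h = √g'`, `G = ∫₀ h` and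
`Φ = ∫₀ g`.

* *Coercivity* (`energy_le_integral_diffForm`). Strong monotonicity of `J_p` for `p < 2`
  (`Jp_sub_mul_sub_ge`) and the Cauchy–Schwarz inequality `(δG)² ≤ δw δg` (`prim_sub_sq_le`) bound
  the tested operator below by `(p-1) ∬ (|δu|+|δv|)^(p-2) |δG(w)|² dμ`. By Hölder's inequality
  (`wspSeminorm_sq_le`) this is at least `(p-1) ([u]+[v])^(p-2) [G(w)]²`, and by the fractional
  Sobolev inequality (`exists_sobolev`) `[G(w)]²` controls `∫_Ω G(w)² ≥ 2 ∫_Ω Φ(w)`. The last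
  inequality, `two_mul_prim_prim_sq_le`, holds for any `h` that is even and nondecreasing on
  `[0,∞)`; it therefore survives truncation with a constant that does not depend on `m`.
* *Sobolev inequality.* Comparing `f(x)` with the values of `f` on a ball of radius `r` about `x`
  and optimising in `r` gives `|f(x)|² ≤ K ‖f‖₂^(2-p₀) D(x)^(p₀/p)` with `p₀ = 2n/(n+2s) ≤ p` and
  `D(x) = ∫ |f(x)-f(y)|^p |x-y|^(-n-sp) dy` (`exists_enorm_sq_le`). Integration over the bounded
  set `Ω` gives the inequality, the critical exponent `p = p₀` included.
* *Energy inequality* (`energy_inequality`). Since `w` is not differentiable in time, `g(w)` is not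
  an admissible test function. By convexity of `Φ`, the increment of `E = ∫_Ω Φ(w)` over `[t-h,t]`
  is at most `∫_Ω g(w(t)) (w(t)-w(t-h))`, to which the weak formulation applies with the
  time-independent test function `g(w(t))`; the right-hand side `f` cancels. Averaging over `t` and
  letting `h → 0`, by continuity of time translations in `L^(p')`, gives
  `E(b) - E(a) ≤ -∫ₐᵇ ⟨(-Δ_p)^s u - (-Δ_p)^s v, g(w)⟩ dt` (`energy_le_of_backward_difference`).

Grönwall's inequality (`le_mul_exp_of_sub_le`) yields the decay of the truncated energies, and
Fatou's lemma (`Im_le_of_forall_trunc`) removes the truncation. If the essential supremum of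
`[u]+[v]` vanishes, the same estimates show `w = 0`.
-/

namespace FracPLap

/-! ### Inequalities for functions of one real variable -/

theorem Jp_neg (p t : ℝ) : Jp p (-t) = -Jp p t := by simp [Jp]

theorem Jp_of_nonneg {p t : ℝ} (hp : 1 < p) (ht : 0 ≤ t) : Jp p t = t ^ (p - 1) := by
  rcases ht.eq_or_lt with rfl | h
  · simp [Jp, Real.zero_rpow (by linarith : p - 1 ≠ 0)]
  · rw [Jp, abs_of_pos h, ← Real.rpow_add_one h.ne']
    congr 1; ring

theorem abs_Jp {p : ℝ} (hp : 1 < p) (t : ℝ) : |Jp p t| = |t| ^ (p - 1) := by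
  rcases le_total 0 t with h | h
  · rw [Jp_of_nonneg hp h, abs_of_nonneg h, abs_of_nonneg (by positivity)]
  · have := Jp_of_nonneg hp (neg_nonneg.2 h)
    rw [Jp_neg] at this
    rw [← abs_neg, this, abs_of_nonpos h, abs_of_nonneg (Real.rpow_nonneg (neg_nonneg.2 h) _)]

theorem measurable_Jp (p : ℝ) : Measurable (Jp p) := by
  unfold Jp; fun_prop

/-- On `[0,R]` the function `J_p` grows at least as fast as the linear function of slope
`(p-1)R^(p-2)`, the smallest value of the derivative of `J_p` there (recall `p < 2`). -/
theorem monotoneOn_Jp_sub {p R : ℝ} (hp : 1 < p) (hp2 : p < 2) :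
    MonotoneOn (fun t => Jp p t - (p - 1) * R ^ (p - 2) * t) (Icc 0 R) := by
  have h1 : MonotoneOn (fun t : ℝ => t ^ (p - 1) - (p - 1) * R ^ (p - 2) * t) (Icc 0 R) := by
    apply monotoneOn_of_deriv_nonneg (convex_Icc 0 R)
    · have : Continuous fun t : ℝ => t ^ (p - 1) := Real.continuous_rpow_const (by linarith)
      fun_prop
    · intro x hx
      rw [interior_Icc] at hx
      exact (((Real.hasDerivAt_rpow_const (Or.inl hx.1.ne')).sub
        ((hasDerivAt_id x).const_mul _)).differentiableAt).differentiableWithinAt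
    · intro x hx
      rw [interior_Icc] at hx
      have := ((Real.hasDerivAt_rpow_const (p := p - 1) (Or.inl hx.1.ne')).sub
        ((hasDerivAt_id x).const_mul ((p - 1) * R ^ (p - 2)))).deriv
      simp only [id] at this
      rw [show (fun t : ℝ => t ^ (p - 1) - (p - 1) * R ^ (p - 2) * t) =
        (fun t : ℝ => t ^ (p - 1)) - fun t => (p - 1) * R ^ (p - 2) * t from rfl, this]
      have h2 : R ^ (p - 2) ≤ x ^ (p - 2) :=
        Real.rpow_le_rpow_of_nonpos hx.1 hx.2.le (by linarith)
      rw [show p - 1 - 1 = p - 2 by ring]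
      nlinarith
  intro x hx y hy hxy
  simpa only [Jp_of_nonneg hp hx.1, Jp_of_nonneg hp hy.1] using h1 hx hy hxy

/-- Strong monotonicity of `J_p` for `1 < p < 2`. -/
theorem Jp_sub_mul_sub_ge {p : ℝ} (hp : 1 < p) (hp2 : p < 2) (a b : ℝ) :
    (p - 1) * (|a| + |b|) ^ (p - 2) * (a - b) ^ 2 ≤ (Jp p a - Jp p b) * (a - b) := by
  wlog hab : b ≤ a generalizing a b
  · have := this b a (le_of_not_ge hab)
    rw [add_comm |b|] at this
    nlinarith
  set R := |a| + |b|
  set c := (p - 1) * R ^ (p - 2)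
  have hm := monotoneOn_Jp_sub (R := R) hp hp2
  have haR : |a| ≤ R := by simp [R]
  have hbR : |b| ≤ R := by simp [R]
  have key : c * (a - b) ≤ Jp p a - Jp p b := by
    have pos : ∀ t, 0 ≤ t → t ≤ R → c * t ≤ Jp p t := fun t ht htR => by
      have := hm ⟨le_rfl, ht.trans htR⟩ ⟨ht, htR⟩ ht
      simp [Jp] at this
      simpa [Jp] using this
    rcases le_total 0 b with hb | hb
    · have := hm ⟨hb, (le_abs_self b).trans hbR⟩
        ⟨hb.trans hab, (le_abs_self a).trans haR⟩ hab
      simp only at this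
      linarith
    · rcases le_total a 0 with ha | ha
      · have := hm ⟨neg_nonneg.2 ha, (neg_le_abs a).trans haR⟩
          ⟨neg_nonneg.2 hb, (neg_le_abs b).trans hbR⟩ (neg_le_neg hab)
        simp only [Jp_neg] at this
        linarith
      · have h1 := pos a ha ((le_abs_self a).trans haR)
        have h2 := pos (-b) (neg_nonneg.2 hb) ((neg_le_abs b).trans hbR)
        rw [Jp_neg] at h2
        linarith
  nlinarith [mul_le_mul_of_nonneg_right key (sub_nonneg.2 hab)]

/-- `∫₀ᵗ h`. -/
noncomputable def prim (h : ℝ → ℝ) (t : ℝ) : ℝ := ∫ x in (0 : ℝ)..t, h x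

theorem prim_zero (h : ℝ → ℝ) : prim h 0 = 0 := by simp [prim]

theorem hasDerivAt_prim {h : ℝ → ℝ} (hc : Continuous h) (t : ℝ) : HasDerivAt (prim h) (h t) t :=
  intervalIntegral.integral_hasDerivAt_right (hc.intervalIntegrable _ _)
    (hc.stronglyMeasurableAtFilter _ _) hc.continuousAt

theorem continuous_prim {h : ℝ → ℝ} (hc : Continuous h) : Continuous (prim h) :=
  continuous_iff_continuousAt.2 fun t => (hasDerivAt_prim hc t).continuousAt

theorem prim_sub {h : ℝ → ℝ} (hc : Continuous h) (a b : ℝ) :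
    prim h a - prim h b = ∫ x in b..a, h x :=
  intervalIntegral.integral_interval_sub_left (hc.intervalIntegrable _ _)
    (hc.intervalIntegrable _ _)

theorem abs_prim_sub_le {h : ℝ → ℝ} (hc : Continuous h) {H : ℝ} (hH : ∀ t, |h t| ≤ H) (a b : ℝ) :
    |prim h a - prim h b| ≤ H * |a - b| := by
  rw [prim_sub hc]
  simpa only [Real.norm_eq_abs] using
    intervalIntegral.norm_integral_le_of_norm_le_const (a := b) (b := a) (f := h) fun x _ => hH x

theorem monotone_prim {h : ℝ → ℝ} (hc : Continuous h) (h0 : ∀ t, 0 ≤ h t) : Monotone (prim h) := by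
  intro a b hab
  have := prim_sub hc b a
  have h2 : 0 ≤ ∫ x in a..b, h x := intervalIntegral.integral_nonneg hab fun x _ => h0 x
  linarith

theorem prim_neg_of_even {h : ℝ → ℝ} (he : ∀ t, h (-t) = h t) (t : ℝ) :
    prim h (-t) = -prim h t := by
  have := intervalIntegral.integral_comp_neg (a := 0) (b := t) h
  simp only [he, neg_zero] at this
  rw [prim, prim, this, intervalIntegral.integral_symm]

theorem prim_neg_of_odd {h : ℝ → ℝ} (ho : ∀ t, h (-t) = -h t) (t : ℝ) :
    prim h (-t) = prim h t := by
  have := intervalIntegral.integral_comp_neg (a := 0) (b := t) h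
  simp only [ho, neg_zero, intervalIntegral.integral_neg] at this
  rw [prim, prim, intervalIntegral.integral_symm]
  linarith

/-- The Cauchy–Schwarz inequality on the interval between `b` and `a`. -/
theorem prim_sub_sq_le {h : ℝ → ℝ} (hc : Continuous h) (a b : ℝ) :
    (prim h a - prim h b) ^ 2 ≤
      (a - b) * (prim (fun t => h t ^ 2) a - prim (fun t => h t ^ 2) b) := by
  wlog hab : b ≤ a generalizing a b
  · nlinarith [this b a (le_of_not_ge hab)]
  rcases hab.eq_or_lt with rfl | hab'
  · simp
  rw [prim_sub hc, prim_sub (by fun_prop : Continuous fun t => h t ^ 2)]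
  -- `∫ (h - c)² ≥ 0` for the mean value `c` of `h`
  set c := (∫ x in b..a, h x) / (a - b) with hcdef
  have hpos : 0 < a - b := sub_pos.2 hab'
  have h1 : 0 ≤ ∫ x in b..a, (h x - c) ^ 2 :=
    intervalIntegral.integral_nonneg hab fun x _ => sq_nonneg _
  have h2 : ∫ x in b..a, (h x - c) ^ 2 =
      (∫ x in b..a, h x ^ 2) - 2 * c * (∫ x in b..a, h x) + c ^ 2 * (a - b) := by
    have : ∀ x, (h x - c) ^ 2 = (h x ^ 2 - 2 * c * h x) + c ^ 2 := fun x => by ring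
    simp only [this]
    rw [intervalIntegral.integral_add, intervalIntegral.integral_sub,
      intervalIntegral.integral_const_mul, intervalIntegral.integral_const, smul_eq_mul]
    · ring
    all_goals exact Continuous.intervalIntegrable (by fun_prop) _ _
  have h3 : ∫ x in b..a, h x = c * (a - b) := by rw [hcdef]; field_simp
  rw [h2, h3] at h1
  rw [h3]
  nlinarith

/-- Convexity of the primitive of a monotone function. -/
theorem prim_sub_le_of_monotone {g : ℝ → ℝ} (hc : Continuous g) (hg : Monotone g) (a b : ℝ) :
    prim g b - prim g a ≤ g b * (b - a) := by
  rw [prim_sub hc]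
  rcases le_total a b with hab | hab
  · have := intervalIntegral.integral_mono_on hab (hc.intervalIntegrable (μ := volume) a b)
      (continuous_const.intervalIntegrable a b) (fun x hx => hg hx.2 : ∀ x ∈ Icc a b, g x ≤ g b)
    simp only [intervalIntegral.integral_const, smul_eq_mul] at this
    linarith
  · have := intervalIntegral.integral_mono_on hab
      (continuous_const.intervalIntegrable b a) (hc.intervalIntegrable (μ := volume) b a)
      (fun x hx => hg hx.1 : ∀ x ∈ Icc b a, g b ≤ g x)
    simp only [intervalIntegral.integral_const, smul_eq_mul] at this
    rw [intervalIntegral.integral_symm]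
    linarith

theorem prim_nonneg_of_monotone {g : ℝ → ℝ} (hc : Continuous g) (hg : Monotone g) (h0 : g 0 = 0)
    (t : ℝ) : 0 ≤ prim g t := by
  have := prim_sub_le_of_monotone hc hg t 0
  rw [prim_zero, h0] at this
  linarith

/-- If `h ≥ 0` is even and nondecreasing on `[0,∞)`, then `2 ∫₀ᵗ ∫₀ʳ h² ≤ (∫₀ᵗ h)²`: for `t ≥ 0` the
derivatives satisfy `2 ∫₀ᵗ h² ≤ 2 h(t) ∫₀ᵗ h`. -/
theorem two_mul_prim_prim_sq_le {h : ℝ → ℝ} (hc : Continuous h) (h0 : ∀ t, 0 ≤ h t)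
    (he : ∀ t, h (-t) = h t) (hm : MonotoneOn h (Ici 0)) (t : ℝ) :
    2 * prim (prim fun t => h t ^ 2) t ≤ prim h t ^ 2 := by
  have hc2 : Continuous fun t => h t ^ 2 := by fun_prop
  wlog ht : 0 ≤ t generalizing t
  · have := this (-t) (by linarith)
    rwa [prim_neg_of_even he, prim_neg_of_odd, neg_sq] at this
    exact prim_neg_of_even (by simp [he])
  have hd : ∀ t, HasDerivAt (fun t => prim h t ^ 2 - 2 * prim (prim fun t => h t ^ 2) t)
      (2 * (prim h t * h t) - 2 * prim (fun t => h t ^ 2) t) t := fun t => by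
    have := ((hasDerivAt_prim hc t).pow 2).sub
      ((hasDerivAt_prim (continuous_prim hc2) t).const_mul 2)
    refine this.congr_deriv ?_
    simp; ring
  have hmono : MonotoneOn (fun t => prim h t ^ 2 - 2 * prim (prim fun t => h t ^ 2) t)
      (Ici 0) := by
    apply monotoneOn_of_deriv_nonneg (convex_Ici 0)
    · exact fun t _ => (hd t).continuousAt.continuousWithinAt
    · exact fun t _ => (hd t).differentiableAt.differentiableWithinAt
    · intro t ht
      rw [interior_Ici] at ht
      rw [(hd t).deriv]
      have : prim (fun t => h t ^ 2) t ≤ prim h t * h t := by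
        rw [prim, prim, ← intervalIntegral.integral_mul_const]
        apply intervalIntegral.integral_mono_on ht.le
          (hc2.intervalIntegrable _ _) ((hc.mul continuous_const).intervalIntegrable _ _)
        intro x hx
        have := hm hx.1 (mem_Ici.2 ht.le) hx.2
        simp only [Pi.mul_apply]
        nlinarith [h0 x]
      linarith
  have := hmono (mem_Ici.2 le_rfl) (mem_Ici.2 ht) ht
  simp only [prim_zero] at this
  linarith

/-- `√(m-1) min(|t|,k)^((m-2)/2)`, the truncation at height `k` of the square root of the second
derivative of `|t|^m / m`. -/
noncomputable def truncRoot (m k t : ℝ) : ℝ := √(m - 1) * (min |t| k) ^ ((m - 2) / 2)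

/-- The truncation of `|t|^(m-2) t`: it is `|t|^(m-2) t` for `|t| ≤ k` and affine for `±t ≥ k`. -/
noncomputable def truncPow (m k : ℝ) : ℝ → ℝ := prim fun t => truncRoot m k t ^ 2

/-- The truncation of `|t|^m / m`, of quadratic growth at infinity. -/
noncomputable def truncEnergy (m k : ℝ) : ℝ → ℝ := prim (truncPow m k)

section trunc

variable {m k : ℝ}

theorem continuous_truncRoot (hm : 2 ≤ m) : Continuous (truncRoot m k) := by
  have : Continuous fun t : ℝ => t ^ ((m - 2) / 2) := Real.continuous_rpow_const (by linarith)
  unfold truncRoot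
  exact continuous_const.mul (this.comp (by fun_prop))

theorem continuous_truncPow (hm : 2 ≤ m) : Continuous (truncPow m k) :=
  continuous_prim ((continuous_truncRoot hm).pow 2)

theorem continuous_truncEnergy (hm : 2 ≤ m) : Continuous (truncEnergy m k) :=
  continuous_prim (continuous_truncPow hm)

theorem truncRoot_nonneg (hk : 0 ≤ k) (t : ℝ) : 0 ≤ truncRoot m k t := by
  unfold truncRoot; positivity

theorem truncRoot_neg (t : ℝ) : truncRoot m k (-t) = truncRoot m k t := by simp [truncRoot]

theorem truncRoot_le (hm : 2 ≤ m) (hk : 0 ≤ k) (t : ℝ) :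
    truncRoot m k t ≤ √(m - 1) * k ^ ((m - 2) / 2) := by
  unfold truncRoot
  have : 0 ≤ min |t| k := le_min (abs_nonneg _) hk
  have h2 : 0 ≤ (m - 2) / 2 := by linarith
  exact mul_le_mul_of_nonneg_left (Real.rpow_le_rpow this (min_le_right _ _) h2) (Real.sqrt_nonneg _)

theorem monotoneOn_truncRoot (hm : 2 ≤ m) (hk : 0 ≤ k) : MonotoneOn (truncRoot m k) (Ici 0) := by
  intro a ha b hb hab
  unfold truncRoot
  rw [abs_of_nonneg ha, abs_of_nonneg hb]
  have : 0 ≤ min a k := le_min ha hk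
  have h2 : 0 ≤ (m - 2) / 2 := by linarith
  gcongr

theorem truncRoot_sq (hm : 2 ≤ m) (hk : 0 ≤ k) (t : ℝ) :
    truncRoot m k t ^ 2 = (m - 1) * min |t| k ^ (m - 2) := by
  have : 0 ≤ min |t| k := le_min (abs_nonneg _) hk
  rw [truncRoot, mul_pow, Real.sq_sqrt (by linarith), ← Real.rpow_natCast, ← Real.rpow_mul this]
  congr 2
  push_cast; ring

theorem truncPow_sub_le (hm : 2 ≤ m) (hk : 0 ≤ k) (a b : ℝ) :
    |truncPow m k a - truncPow m k b| ≤ (√(m - 1) * k ^ ((m - 2) / 2)) ^ 2 * |a - b| := by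
  refine abs_prim_sub_le ((continuous_truncRoot hm).pow 2) (fun t => ?_) a b
  rw [abs_of_nonneg (sq_nonneg _)]
  exact pow_le_pow_left₀ (truncRoot_nonneg hk t) (truncRoot_le hm hk t) 2

theorem truncPow_zero : truncPow m k 0 = 0 := prim_zero _

theorem monotone_truncPow (hm : 2 ≤ m) : Monotone (truncPow m k) :=
  monotone_prim ((continuous_truncRoot hm).pow 2) fun _ => sq_nonneg _

theorem truncPow_neg (t : ℝ) : truncPow m k (-t) = -truncPow m k t :=
  prim_neg_of_even (by simp [truncRoot_neg]) t

theorem truncEnergy_neg (t : ℝ) : truncEnergy m k (-t) = truncEnergy m k t :=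
  prim_neg_of_odd truncPow_neg t

theorem truncEnergy_nonneg (hm : 2 ≤ m) (t : ℝ) : 0 ≤ truncEnergy m k t :=
  prim_nonneg_of_monotone (continuous_truncPow hm) (monotone_truncPow hm) truncPow_zero t

theorem truncPow_of_nonneg_le (hm : 2 ≤ m) (hk : 0 ≤ k) {t : ℝ} (ht : 0 ≤ t) :
    truncPow m k t ≤ t ^ (m - 1) ∧ (t ≤ k → truncPow m k t = t ^ (m - 1)) := by
  have h1 : ∫ x in (0 : ℝ)..t, (m - 1) * x ^ (m - 2) = t ^ (m - 1) := by
    rw [intervalIntegral.integral_const_mul, integral_rpow (Or.inl (by linarith)),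
      show m - 2 + 1 = m - 1 by ring, Real.zero_rpow (by linarith)]
    have : m - 1 ≠ 0 := by linarith
    field_simp; ring
  have hcont : Continuous fun x : ℝ => (m - 1) * x ^ (m - 2) :=
    continuous_const.mul (Real.continuous_rpow_const (by linarith))
  constructor
  · rw [← h1]
    apply intervalIntegral.integral_mono_on ht
      (((continuous_truncRoot hm).pow 2).intervalIntegrable _ _) (hcont.intervalIntegrable _ _)
    intro x hx
    rw [Pi.pow_apply, truncRoot_sq hm hk, abs_of_nonneg hx.1]
    have : 0 ≤ min x k := le_min hx.1 hk
    have h2 : 0 ≤ m - 2 := by linarith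
    have h3 : 0 ≤ m - 1 := by linarith
    gcongr
    exact min_le_left _ _
  · intro htk
    rw [← h1]
    apply intervalIntegral.integral_congr
    intro x hx
    rw [uIcc_of_le ht] at hx
    simp only
    rw [truncRoot_sq hm hk, abs_of_nonneg hx.1, min_eq_left (hx.2.trans htk)]

theorem truncEnergy_le (hm : 2 ≤ m) (hk : 0 ≤ k) (t : ℝ) :
    truncEnergy m k t ≤ |t| ^ m / m ∧ (|t| ≤ k → truncEnergy m k t = |t| ^ m / m) := by
  wlog ht : 0 ≤ t generalizing t
  · have := this (-t) (by linarith)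
    rwa [truncEnergy_neg, abs_neg] at this
  rw [abs_of_nonneg ht]
  have h1 : ∫ x in (0 : ℝ)..t, x ^ (m - 1) = t ^ m / m := by
    rw [integral_rpow (Or.inl (by linarith)),
      show m - 1 + 1 = m by ring, Real.zero_rpow (by linarith), sub_zero]
  constructor
  · rw [← h1]
    exact intervalIntegral.integral_mono_on ht ((continuous_truncPow hm).intervalIntegrable _ _)
      ((Real.continuous_rpow_const (by linarith)).intervalIntegrable _ _)
      fun x hx => (truncPow_of_nonneg_le hm hk hx.1).1
  · intro htk
    rw [← h1]
    apply intervalIntegral.integral_congr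
    intro x hx
    rw [uIcc_of_le ht] at hx
    exact (truncPow_of_nonneg_le hm hk hx.1).2 (hx.2.trans htk)

end trunc

/-- The monotonicity of `J_p` against the increments of `∫ h²` controls the squared increments
of `∫ h`. -/
theorem Jp_sub_mul_prim_sub_ge {p : ℝ} (hp : 1 < p) (hp2 : p < 2) {h : ℝ → ℝ} (hc : Continuous h)
    {a b x y : ℝ} (hxy : a - b = x - y) :
    (p - 1) * ((|a| + |b|) ^ (p - 2) * (prim h x - prim h y) ^ 2) ≤
      (Jp p a - Jp p b) * (prim (fun t => h t ^ 2) x - prim (fun t => h t ^ 2) y) := by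
  rcases eq_or_ne x y with rfl | hne
  · simp
  have h1 := prim_sub_sq_le hc x y
  have h2 := Jp_sub_mul_sub_ge hp hp2 a b
  rw [hxy] at h2
  set d := x - y
  set e := prim (fun t => h t ^ 2) x - prim (fun t => h t ^ 2) y
  have hd : d ≠ 0 := sub_ne_zero.2 hne
  have hde : 0 ≤ d * e := (sq_nonneg _).trans h1
  have hq : 0 ≤ e / d := by
    have : e / d = d * e / d ^ 2 := by field_simp
    rw [this]; positivity
  have hR : 0 ≤ (p - 1) * (|a| + |b|) ^ (p - 2) :=
    mul_nonneg (by linarith) (Real.rpow_nonneg (by positivity) _)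
  calc _ = (p - 1) * (|a| + |b|) ^ (p - 2) * (prim h x - prim h y) ^ 2 := by ring
    _ ≤ (p - 1) * (|a| + |b|) ^ (p - 2) * (d * e) := mul_le_mul_of_nonneg_left h1 hR
    _ = e / d * ((p - 1) * (|a| + |b|) ^ (p - 2) * d ^ 2) := by field_simp
    _ ≤ e / d * ((Jp p a - Jp p b) * d) := mul_le_mul_of_nonneg_left h2 hq
    _ = _ := by field_simp

/-! ### The fractional Sobolev inequality -/

/-- Hölder's inequality against the constant function `1`. -/
theorem lintegral_le_lintegral_rpow_mul {α : Type*} [MeasurableSpace α] (μ : Measure α) {p : ℝ}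
    (hp : 1 ≤ p) {F : α → ℝ≥0∞} (hF : AEMeasurable F μ) :
    ∫⁻ x, F x ∂μ ≤ (∫⁻ x, F x ^ p ∂μ) ^ (1 / p) * μ univ ^ (1 - 1 / p) := by
  rcases hp.eq_or_lt with rfl | hp
  · simp
  have hq := Real.HolderConjugate.conjExponent hp
  have := ENNReal.lintegral_mul_le_Lp_mul_Lq μ hq hF (aemeasurable_const (b := (1 : ℝ≥0∞)))
  have h1 : 1 / p.conjExponent = 1 - 1 / p := by
    have := hq.inv_add_inv_eq_one
    rw [one_div, one_div]; linarith
  simpa [h1] using this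

/-- `∫ |f(x)-f(y)|^p |x-y|^(-n-sp) dy`. -/
noncomputable def innerEnergy {n : ℕ} (s p : ℝ) (f : Rn n → ℝ) (x : Rn n) : ℝ≥0∞ :=
  ∫⁻ y, ‖f x - f y‖ₑ ^ p * ENNReal.ofReal (‖x - y‖ ^ (-((n : ℝ) + s * p)))

theorem measurable_kernel (n : ℕ) (s p : ℝ) : Measurable fun z : Rn n × Rn n =>
    ENNReal.ofReal (‖z.1 - z.2‖ ^ (-((n : ℝ) + s * p))) := by fun_prop

theorem aestronglyMeasurable_sub_prod {n : ℕ} {f : Rn n → ℝ} (hf : AEStronglyMeasurable f volume) :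
    AEStronglyMeasurable (fun z : Rn n × Rn n => f z.1 - f z.2) volume :=
  (hf.comp_fst (ν := volume)).sub hf.comp_snd

theorem dmu_absolutelyContinuous (n : ℕ) (s p : ℝ) :
    dmu n s p ≪ (volume : Measure (Rn n × Rn n)) := withDensity_absolutelyContinuous _ _

theorem wspSeminorm_rpow {n : ℕ} {s p : ℝ} (hp : 0 < p) (f : Rn n → ℝ) :
    wspSeminorm s p univ f ^ p = ∫⁻ z, ‖f z.1 - f z.2‖ₑ ^ p ∂(dmu n s p) := by
  rw [wspSeminorm, ← ENNReal.rpow_mul, one_div, inv_mul_cancel₀ hp.ne', ENNReal.rpow_one]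
  simp

theorem lintegral_innerEnergy {n : ℕ} {s p : ℝ} (hp : 0 < p) {f : Rn n → ℝ}
    (hf : AEStronglyMeasurable f volume) :
    ∫⁻ x, innerEnergy s p f x = wspSeminorm s p univ f ^ p := by
  rw [wspSeminorm_rpow hp, dmu, lintegral_withDensity_eq_lintegral_mul_non_measurable _
    (measurable_kernel n s p) (by simp), Measure.volume_eq_prod, lintegral_prod]
  · simp only [Pi.mul_apply, mul_comm, innerEnergy]
  · exact (measurable_kernel n s p).aemeasurable.mul
      ((aestronglyMeasurable_sub_prod hf).enorm.pow_const p)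

theorem aemeasurable_innerEnergy {n : ℕ} {s p : ℝ} {f : Rn n → ℝ}
    (hf : AEStronglyMeasurable f volume) : AEMeasurable (innerEnergy s p f) volume := by
  refine AEMeasurable.lintegral_prod_right' (ν := volume) (f := fun z : Rn n × Rn n =>
    ‖f z.1 - f z.2‖ₑ ^ p * ENNReal.ofReal (‖z.1 - z.2‖ ^ (-((n : ℝ) + s * p)))) ?_
  exact ((aestronglyMeasurable_sub_prod hf).enorm.pow_const p).mul
    (measurable_kernel n s p).aemeasurable

/-- Comparison of `f(x)` with the values of `f` on the ball of radius `r` about `x`. -/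
theorem enorm_mul_volume_ball_le {n : ℕ} {s p : ℝ} (hs : 0 < s) (hp : 1 < p) {f : Rn n → ℝ}
    (hf : AEStronglyMeasurable f volume) (x : Rn n) {r : ℝ} (hr : 0 < r) :
    ‖f x‖ₑ * volume (Metric.ball x r) ≤
      ENNReal.ofReal (r ^ (((n : ℝ) + s * p) / p)) * innerEnergy s p f x ^ (1 / p) *
          volume (Metric.ball x r) ^ (1 - 1 / p) +
        (∫⁻ y, ‖f y‖ₑ ^ (2 : ℝ)) ^ (1 / (2 : ℝ)) * volume (Metric.ball x r) ^ (1 / (2 : ℝ)) := by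
  set B := Metric.ball x r
  have hp0 : 0 < p := by linarith
  have hm : AEMeasurable (fun y => ‖f x - f y‖ₑ) (volume.restrict B) :=
    (aestronglyMeasurable_const.sub hf).enorm.restrict
  have h1 : ‖f x‖ₑ * volume B ≤ (∫⁻ y in B, ‖f x - f y‖ₑ) + ∫⁻ y in B, ‖f y‖ₑ := by
    rw [← lintegral_add_left' hm, ← setLIntegral_const]
    refine lintegral_mono fun y => ?_
    calc ‖f x‖ₑ = ‖(f x - f y) + f y‖ₑ := by simp
      _ ≤ _ := enorm_add_le _ _
  refine h1.trans (add_le_add ?_ ?_)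
  · refine (lintegral_le_lintegral_rpow_mul _ hp.le hm).trans ?_
    rw [Measure.restrict_apply_univ]
    gcongr
    have h2 : ∫⁻ y in B, ‖f x - f y‖ₑ ^ p ≤
        ENNReal.ofReal (r ^ ((n : ℝ) + s * p)) * innerEnergy s p f x := by
      rw [innerEnergy, ← lintegral_const_mul' _ _ ENNReal.ofReal_ne_top]
      refine (setLIntegral_mono' Metric.isOpen_ball.measurableSet fun y hy => ?_).trans
        (setLIntegral_le_lintegral _ _)
      rcases eq_or_ne x y with rfl | hxy
      · simp [hp0]
      have hxy' : 0 < ‖x - y‖ := norm_pos_iff.2 (sub_ne_zero.2 hxy)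
      have hle : ‖x - y‖ ≤ r := by
        rw [← dist_eq_norm, dist_comm]; exact (Metric.mem_ball.1 hy).le
      have : 1 ≤ ENNReal.ofReal (r ^ ((n : ℝ) + s * p)) *
          ENNReal.ofReal (‖x - y‖ ^ (-((n : ℝ) + s * p))) := by
        rw [← ENNReal.ofReal_mul (by positivity), ENNReal.one_le_ofReal, Real.rpow_neg hxy'.le,
          ← div_eq_mul_inv, one_le_div (by positivity)]
        gcongr
      calc ‖f x - f y‖ₑ ^ p = ‖f x - f y‖ₑ ^ p * 1 := (mul_one _).symm
        _ ≤ ‖f x - f y‖ₑ ^ p * (ENNReal.ofReal (r ^ ((n : ℝ) + s * p)) *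
          ENNReal.ofReal (‖x - y‖ ^ (-((n : ℝ) + s * p)))) := by gcongr
        _ = _ := by ring
    refine (ENNReal.rpow_le_rpow h2 (by positivity)).trans_eq ?_
    rw [ENNReal.mul_rpow_of_nonneg _ _ (by positivity), ENNReal.ofReal_rpow_of_nonneg
      (by positivity) (by positivity), ← Real.rpow_mul hr.le, mul_one_div]
  · refine (lintegral_le_lintegral_rpow_mul _ one_le_two hf.enorm.restrict).trans ?_
    rw [Measure.restrict_apply_univ, show (1 : ℝ) - 1 / 2 = 1 / 2 by norm_num]
    gcongr
    exact Measure.restrict_le_self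

/-- Optimisation in `r` of a bound `r^s d + r^(-n/2) N`; for `d > 0` the two summands agree at
`r = (N/d)^(2/(n+2s))`, and for `d = 0` one lets `r → ∞`. -/
theorem le_of_forall_radius {n : ℕ} (hn : 0 < n) {s a c d N : ℝ} (hs : 0 < s)
    (hd : 0 ≤ d) (hN : 0 < N)
    (h : ∀ r : ℝ, 0 < r → a ≤ c * (r ^ s * d + r ^ (-(n / 2 : ℝ)) * N)) :
    a ≤ 2 * c * (d ^ ((n : ℝ) / (n + 2 * s)) * N ^ (1 - (n : ℝ) / (n + 2 * s))) := by
  have hn' : (0 : ℝ) < n := by exact_mod_cast hn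
  have hns : (0 : ℝ) < n + 2 * s := by positivity
  rcases hd.eq_or_lt with rfl | hd
  · rw [Real.zero_rpow (by positivity)]
    have ht : Filter.Tendsto (fun r : ℝ => c * (r ^ s * 0 + r ^ (-(n / 2 : ℝ)) * N)) Filter.atTop
        (nhds (c * (0 + 0 * N))) := by
      simp only [mul_zero]
      exact ((tendsto_const_nhds.add
        ((tendsto_rpow_neg_atTop (by positivity)).mul_const N))).const_mul c
    have := ge_of_tendsto ht ((Filter.eventually_gt_atTop 0).mono h)
    simpa using this
  · have h1 := h ((N / d) ^ (2 / ((n : ℝ) + 2 * s))) (by positivity)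
    rw [← Real.rpow_mul (by positivity), ← Real.rpow_mul (by positivity)] at h1
    have e1 : (N / d) ^ (2 / ((n : ℝ) + 2 * s) * s) * d =
        d ^ ((n : ℝ) / (n + 2 * s)) * N ^ (1 - (n : ℝ) / (n + 2 * s)) := by
      have : 2 / ((n : ℝ) + 2 * s) * s = 1 - (n : ℝ) / (n + 2 * s) := by field_simp; ring
      rw [this, Real.div_rpow hN.le hd.le, Real.rpow_sub hd, Real.rpow_one]
      field_simp
    have e2 : (N / d) ^ (2 / ((n : ℝ) + 2 * s) * -(n / 2 : ℝ)) * N =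
        d ^ ((n : ℝ) / (n + 2 * s)) * N ^ (1 - (n : ℝ) / (n + 2 * s)) := by
      have : 2 / ((n : ℝ) + 2 * s) * -(n / 2 : ℝ) = -((n : ℝ) / (n + 2 * s)) := by field_simp
      rw [this, Real.rpow_neg (by positivity), Real.div_rpow hN.le hd.le, Real.rpow_sub hN,
        Real.rpow_one]
      field_simp
    rw [e1, e2] at h1
    linarith

/-- The pointwise form of the Sobolev inequality. -/
theorem exists_enorm_sq_le {n : ℕ} (hn : 0 < n) {s p : ℝ} (hs : 0 < s) (hp : 1 < p) :
    ∃ K : ℝ≥0∞, K ≠ ⊤ ∧ ∀ f : Rn n → ℝ, AEStronglyMeasurable f volume →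
      ∫⁻ y, ‖f y‖ₑ ^ (2 : ℝ) ≠ 0 → ∫⁻ y, ‖f y‖ₑ ^ (2 : ℝ) ≠ ⊤ → ∀ x,
      ‖f x‖ₑ ^ (2 : ℝ) ≤ K * (∫⁻ y, ‖f y‖ₑ ^ (2 : ℝ)) ^ (1 - (n : ℝ) / (n + 2 * s)) *
        innerEnergy s p f x ^ (2 * ((n : ℝ) / (n + 2 * s)) / p) := by
  have hn' : (0 : ℝ) < n := by exact_mod_cast hn
  have hp0 : 0 < p := by linarith
  set θ := (n : ℝ) / (n + 2 * s) with hθ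
  have hθ0 : 0 < θ := by positivity
  have hθ1 : θ < 1 := by rw [hθ, div_lt_one (by positivity)]; linarith
  set vol := (volume (Metric.ball (0 : Rn n) 1)).toReal with hvol
  have hvol0 : 0 < vol := ENNReal.toReal_pos (Metric.measure_ball_pos _ _ one_pos).ne'
    measure_ball_lt_top.ne
  set c := vol ^ (-(1 / p)) + vol ^ (-(1 / (2 : ℝ))) with hc
  refine ⟨ENNReal.ofReal ((2 * c) ^ (2 : ℝ)), ENNReal.ofReal_ne_top, fun f hf h0 htop x => ?_⟩
  set N2 := ∫⁻ y, ‖f y‖ₑ ^ (2 : ℝ) with hN2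
  rcases eq_or_ne (innerEnergy s p f x) ⊤ with hD | hD
  · rw [hD, ENNReal.top_rpow_of_pos (by positivity), ENNReal.mul_top]
    · exact le_top
    · refine mul_ne_zero ?_ ?_
      · rw [Ne, ENNReal.ofReal_eq_zero, not_le]; positivity
      · simp [ENNReal.rpow_eq_zero_iff, h0, htop]
  set d := (innerEnergy s p f x ^ (1 / p)).toReal with hd
  set N := (N2 ^ (1 / (2 : ℝ))).toReal with hN
  have hdt : innerEnergy s p f x ^ (1 / p) ≠ ⊤ := ENNReal.rpow_ne_top_of_nonneg (by positivity) hD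
  have hNt : N2 ^ (1 / (2 : ℝ)) ≠ ⊤ := ENNReal.rpow_ne_top_of_nonneg (by positivity) htop
  have hN0 : 0 < N := ENNReal.toReal_pos (by simp [ENNReal.rpow_eq_zero_iff, h0]) hNt
  have key : ∀ r : ℝ, 0 < r → |f x| ≤ c * (r ^ s * d + r ^ (-(n / 2 : ℝ)) * N) := by
    intro r hr
    have h1 := enorm_mul_volume_ball_le hs hp hf x hr
    have hV : volume (Metric.ball x r) = ENNReal.ofReal (r ^ (n : ℝ) * vol) := by
      rw [Measure.addHaar_ball_of_pos _ _ hr, ENNReal.ofReal_mul (by positivity), hvol,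
        ENNReal.ofReal_toReal measure_ball_lt_top.ne]
      simp
    have hV0 : 0 < r ^ (n : ℝ) * vol := by positivity
    rw [hV, ← ENNReal.ofReal_toReal hdt, ← ENNReal.ofReal_toReal hNt,
      ENNReal.ofReal_rpow_of_pos hV0, ENNReal.ofReal_rpow_of_pos hV0, Real.enorm_eq_ofReal_abs,
      ← ENNReal.ofReal_mul (by positivity), ← ENNReal.ofReal_mul (by positivity),
      ← ENNReal.ofReal_mul (by positivity), ← ENNReal.ofReal_mul (by positivity),
      ← ENNReal.ofReal_add (by positivity) (by positivity),
      ENNReal.ofReal_le_ofReal_iff (by positivity), ← hd, ← hN] at h1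
    set V := r ^ (n : ℝ) * vol with hVdef
    have e1 : V ^ (1 - 1 / p) = V * (r ^ (-((n : ℝ) / p)) * vol ^ (-(1 / p))) := by
      rw [sub_eq_add_neg, Real.rpow_add hV0, Real.rpow_one, hVdef, Real.mul_rpow (by positivity)
        hvol0.le, ← Real.rpow_mul hr.le]
      congr 4; ring
    have e2 : V ^ (1 / (2 : ℝ)) = V * (r ^ (-(n / 2 : ℝ)) * vol ^ (-(1 / (2 : ℝ)))) := by
      rw [show (1 : ℝ) / 2 = 1 + -(1 / 2) by norm_num, Real.rpow_add hV0, Real.rpow_one, hVdef,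
        Real.mul_rpow (by positivity) hvol0.le, ← Real.rpow_mul hr.le]
      congr 3
      · ring
      · norm_num
    have e3 : r ^ (((n : ℝ) + s * p) / p) * r ^ (-((n : ℝ) / p)) = r ^ s := by
      rw [← Real.rpow_add hr]; congr 1; field_simp; ring
    rw [e1, e2] at h1
    have h2 : |f x| * V ≤
        (vol ^ (-(1 / p)) * (r ^ s * d) + vol ^ (-(1 / (2 : ℝ))) * (r ^ (-(n / 2 : ℝ)) * N)) * V := by
      rw [← e3]; refine h1.trans_eq ?_; ring
    have h3 := le_of_mul_le_mul_right h2 hV0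
    refine h3.trans ?_
    have a1 : 0 ≤ vol ^ (-(1 / p)) := by positivity
    have a2 : 0 ≤ vol ^ (-(1 / (2 : ℝ))) := by positivity
    have a3 : 0 ≤ r ^ s * d := by positivity
    have a4 : 0 ≤ r ^ (-(n / 2 : ℝ)) * N := by positivity
    rw [hc]
    nlinarith [mul_nonneg a1 a4, mul_nonneg a2 a3]
  have h4 := le_of_forall_radius hn hs ENNReal.toReal_nonneg hN0 key
  rw [← hθ] at h4
  have h5 : ‖f x‖ₑ ≤ ENNReal.ofReal (2 * c) *
      ((innerEnergy s p f x ^ (1 / p)) ^ θ * (N2 ^ (1 / (2 : ℝ))) ^ (1 - θ)) := by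
    have q1 : 0 ≤ 1 - θ := by linarith
    rw [← ENNReal.ofReal_toReal hdt, ← ENNReal.ofReal_toReal hNt,
      ENNReal.ofReal_rpow_of_nonneg ENNReal.toReal_nonneg hθ0.le,
      ENNReal.ofReal_rpow_of_nonneg ENNReal.toReal_nonneg q1,
      ← ENNReal.ofReal_mul (by positivity), ← ENNReal.ofReal_mul (by positivity),
      Real.enorm_eq_ofReal_abs]
    exact ENNReal.ofReal_le_ofReal h4
  refine (ENNReal.rpow_le_rpow h5 zero_le_two).trans_eq ?_
  rw [ENNReal.mul_rpow_of_nonneg _ _ zero_le_two, ENNReal.mul_rpow_of_nonneg _ _ zero_le_two,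
    ENNReal.ofReal_rpow_of_nonneg (by positivity) zero_le_two]
  simp only [← ENNReal.rpow_mul]
  rw [show 1 / p * θ * 2 = 2 * θ / p by ring, show 1 / 2 * (1 - θ) * 2 = 1 - θ by ring]
  ring

/-- The fractional Sobolev inequality `‖f‖_{L²(Ω)} ≤ C [f]_{W^{s,p}(ℝⁿ)}` for functions vanishing
outside a bounded set `Ω`. The case `p = 2n/(n+2s)` of the critical exponent is included: there the
pointwise bound reads `|f(x)|² ≤ K ‖f‖₂^(2-p) ∫ |f(x)-f(y)|^p |x-y|^(-n-sp) dy`, and it can be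
integrated because `‖f‖₂` is known to be finite. -/
theorem exists_sobolev {n : ℕ} (hn : 0 < n) {s p : ℝ} (hs : 0 < s) (hp1 : 1 < p)
    (hp : 2 * (n : ℝ) / ((n : ℝ) + 2 * s) ≤ p) {Ω : Set (Rn n)} (hΩ : MeasurableSet Ω)
    (hΩb : Bornology.IsBounded Ω) :
    ∃ C : ℝ, 0 < C ∧ ∀ f : Rn n → ℝ, AEStronglyMeasurable f volume →
      (∀ᵐ x, x ∉ Ω → f x = 0) → ∫⁻ x in Ω, ‖f x‖ₑ ^ (2 : ℝ) ≠ ⊤ →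
      ∫⁻ x in Ω, ‖f x‖ₑ ^ (2 : ℝ) ≤ ENNReal.ofReal C * wspSeminorm s p univ f ^ (2 : ℝ) := by
  have hn' : (0 : ℝ) < n := by exact_mod_cast hn
  have hp0 : 0 < p := by linarith
  obtain ⟨K, hK, hKf⟩ := exists_enorm_sq_le hn hs hp1
  set θ := (n : ℝ) / (n + 2 * s) with hθ
  have hθ0 : 0 < θ := by positivity
  have hθp : 2 * θ ≤ p := by rw [hθ, ← mul_div_assoc]; exact hp
  set e := 2 * θ / p with he
  have he0 : 0 < e := by positivity
  have he1 : e ≤ 1 := by rw [he, div_le_one hp0]; exact hθp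
  set K' := (K * volume Ω ^ (1 - e)) ^ (1 / θ) with hK'
  have hK't : K' ≠ ⊤ := by
    refine ENNReal.rpow_ne_top_of_nonneg (by positivity) (ENNReal.mul_ne_top hK ?_)
    exact ENNReal.rpow_ne_top_of_nonneg (by linarith) hΩb.measure_lt_top.ne
  refine ⟨K'.toReal + 1, by positivity, fun f hf hf0 hft => ?_⟩
  have hu : ∫⁻ y, ‖f y‖ₑ ^ (2 : ℝ) = ∫⁻ y in Ω, ‖f y‖ₑ ^ (2 : ℝ) := by
    rw [← lintegral_indicator hΩ]
    refine lintegral_congr_ae ?_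
    filter_upwards [hf0] with x hx
    by_cases h : x ∈ Ω
    · simp [h]
    · simp [h, hx h]
  set N2 := ∫⁻ y in Ω, ‖f y‖ₑ ^ (2 : ℝ) with hN2
  rcases eq_or_ne N2 0 with h0 | h0
  · rw [h0]; exact zero_le
  have h1 : N2 ≤ K * N2 ^ (1 - θ) * (wspSeminorm s p univ f ^ (2 * θ) * volume Ω ^ (1 - e)) := by
    have hx := hKf f hf (by rwa [hu]) (by rwa [hu])
    rw [hu] at hx
    calc N2 ≤ ∫⁻ x in Ω, K * N2 ^ (1 - θ) * innerEnergy s p f x ^ e := lintegral_mono hx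
      _ = K * N2 ^ (1 - θ) * ∫⁻ x in Ω, innerEnergy s p f x ^ e := by
        rw [lintegral_const_mul']
        exact ENNReal.mul_ne_top hK (by simp [ENNReal.rpow_eq_top_iff, h0, hft])
      _ ≤ _ := by
        gcongr
        have hinv : 1 / (1 / e) = e := one_div_one_div e
        have h2 := lintegral_le_lintegral_rpow_mul (volume.restrict Ω)
          (p := 1 / e) ((one_le_div he0).2 he1)
          ((aemeasurable_innerEnergy (s := s) (p := p) hf).restrict.pow_const e)
        rw [Measure.restrict_apply_univ, hinv] at h2
        refine h2.trans ?_
        gcongr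
        have h3 : ∀ x, (innerEnergy s p f x ^ e) ^ (1 / e) = innerEnergy s p f x := fun x => by
          rw [← ENNReal.rpow_mul, mul_one_div_cancel he0.ne', ENNReal.rpow_one]
        simp only [h3]
        refine (ENNReal.rpow_le_rpow (setLIntegral_le_lintegral _ _) he0.le).trans_eq ?_
        rw [lintegral_innerEnergy hp0 hf, ← ENNReal.rpow_mul]
        congr 1; rw [he]; field_simp
  have h2 : N2 ^ θ ≤ K * volume Ω ^ (1 - e) * wspSeminorm s p univ f ^ (2 * θ) := by
    have hne : N2 ^ (1 - θ) ≠ 0 := by simp [ENNReal.rpow_eq_zero_iff, h0, hft]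
    have hnt : N2 ^ (1 - θ) ≠ ⊤ := by simp [ENNReal.rpow_eq_top_iff, h0, hft]
    rw [← ENNReal.mul_le_mul_iff_right hne hnt, ← ENNReal.rpow_add _ _ h0 hft, sub_add_cancel,
      ENNReal.rpow_one]
    refine h1.trans_eq ?_
    ring
  have h3 := ENNReal.rpow_le_rpow h2 (z := 1 / θ) (by positivity)
  rw [← ENNReal.rpow_mul, mul_one_div_cancel hθ0.ne', ENNReal.rpow_one,
    ENNReal.mul_rpow_of_nonneg _ _ (by positivity), ← ENNReal.rpow_mul,
    show 2 * θ * (1 / θ) = 2 by field_simp] at h3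
  refine h3.trans ?_
  gcongr
  rw [← hK', ENNReal.ofReal_add ENNReal.toReal_nonneg zero_le_one, ENNReal.ofReal_toReal hK't]
  exact le_self_add

/-! ### Averaging in time -/

theorem lintegral_enorm_mul_le {α : Type*} [MeasurableSpace α] {μ : Measure α} {p q : ℝ≥0∞}
    [hpq : ENNReal.HolderConjugate q p] {A D : α → ℝ} (hA : AEStronglyMeasurable A μ)
    (hD : AEStronglyMeasurable D μ) :
    ∫⁻ z, ‖A z * D z‖ₑ ∂μ ≤ eLpNorm A q μ * eLpNorm D p μ := by
  have := eLpNorm_smul_le_mul_eLpNorm (p := q) (q := p) (r := 1) hD hA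
  rwa [eLpNorm_one_eq_lintegral_enorm] at this

/-- Hölder's inequality for the pairing of `L^q` and `L^p`. -/
theorem abs_integral_mul_le {α : Type*} [MeasurableSpace α] {μ : Measure α} {p q : ℝ≥0∞}
    [hpq : ENNReal.HolderConjugate q p] {A D : α → ℝ} (hA : MemLp A q μ) (hD : MemLp D p μ) :
    |∫ z, A z * D z ∂μ| ≤ (eLpNorm A q μ * eLpNorm D p μ).toReal := by
  rw [← Real.norm_eq_abs, ← toReal_enorm]
  exact ENNReal.toReal_mono (ENNReal.mul_ne_top hA.2.ne hD.2.ne)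
    ((enorm_integral_le_lintegral_enorm _).trans (lintegral_enorm_mul_le hA.1 hD.1))

section energy

variable {Y : Type*} [MeasureSpace Y] [SigmaFinite (volume : Measure Y)]

theorem measurePreserving_timeShift (σ : ℝ) :
    MeasurePreserving (fun z : ℝ × Y => (z.1 - σ, z.2)) volume volume :=
  (measurePreserving_sub_right volume σ).prod (MeasurePreserving.id volume)

/-- The integrability behind the exchange of the average over the shift with the time integral. -/
theorem integrable_timeShift_mul {p q : ℝ≥0∞} [hpq : ENNReal.HolderConjugate q p]
    {A D : ℝ × Y → ℝ} (hA : MemLp A q volume) (hD : MemLp D p volume) (h : ℝ) :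
    Integrable (fun w : ℝ × (ℝ × Y) => A (w.2.1 - w.1, w.2.2) * D w.2)
      ((volume.restrict (Icc 0 h)).prod volume) := by
  have hq : Measure.QuasiMeasurePreserving
      (fun w : ℝ × (ℝ × Y) => ((w.2.1 - w.1, w.2.2) : ℝ × Y))
      ((volume.restrict (Icc 0 h)).prod volume) volume := by
    refine QuasiMeasurePreserving.prod_of_right ?_ ?_
    · fun_prop
    · exact Filter.Eventually.of_forall fun σ =>
        (measurePreserving_timeShift σ).quasiMeasurePreserving
  have hm : AEStronglyMeasurable (fun w : ℝ × (ℝ × Y) => A (w.2.1 - w.1, w.2.2) * D w.2)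
      ((volume.restrict (Icc 0 h)).prod volume) :=
    (hA.1.comp_quasiMeasurePreserving hq).mul hD.1.comp_snd
  refine ⟨hm, ?_⟩
  rw [HasFiniteIntegral, lintegral_prod _ hm.enorm]
  have hle : ∀ σ : ℝ, ∫⁻ z : ℝ × Y, ‖A (z.1 - σ, z.2) * D z‖ₑ ≤
      eLpNorm A q volume * eLpNorm D p volume := fun σ => by
    have hs := hA.comp_measurePreserving (measurePreserving_timeShift (Y := Y) σ)
    refine (lintegral_enorm_mul_le (q := q) (p := p) hs.1 hD.1).trans_eq ?_
    congr 1
    exact eLpNorm_comp_measurePreserving hA.1 (measurePreserving_timeShift σ)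
  refine (lintegral_mono hle).trans_lt ?_
  rw [lintegral_const, Measure.restrict_apply_univ]
  exact ENNReal.mul_lt_top (ENNReal.mul_lt_top hA.2 hD.2) (by simp)

variable [NormedAddCommGroup Y] [ProperSpace Y] [SecondCountableTopology Y] [BorelSpace Y]
  [IsLocallyFiniteMeasure (volume : Measure Y)]

/-- Translations in time are continuous in `L^q(ℝ × Y)`. -/
theorem tendsto_eLpNorm_timeShift_sub {q : ℝ≥0∞} (hq1 : 1 ≤ q) (hq : q ≠ ⊤) {F : ℝ × Y → ℝ}
    (hF : MemLp F q volume) :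
    Filter.Tendsto (fun σ : ℝ => eLpNorm (fun z : ℝ × Y => F (z.1 - σ, z.2) - F z) q volume)
      (nhds 0) (nhds 0) := by
  have : Fact (1 ≤ q) := ⟨hq1⟩
  let g : C(ℝ, C(ℝ × Y, ℝ × Y)) :=
    (ContinuousMap.mk (fun a : ℝ × (ℝ × Y) => ((a.2.1 - a.1, a.2.2) : ℝ × Y))
      (by fun_prop)).curry
  have hgm : ∀ σ, MeasurePreserving (g σ) volume volume := measurePreserving_timeShift
  have h1 : Filter.Tendsto (fun σ => Lp.compMeasurePreserving (g σ) (hgm σ) (hF.toLp F)) (nhds 0)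
      (nhds (Lp.compMeasurePreserving (g 0) (hgm 0) (hF.toLp F))) :=
    Filter.Tendsto.compMeasurePreservingLp tendsto_const_nhds (g.continuous.tendsto 0) hgm
      (hgm 0) hq
  have h2 := (tendsto_iff_edist_tendsto_0.1 h1)
  refine h2.congr fun σ => ?_
  rw [Lp.edist_def]
  refine eLpNorm_congr_ae ?_
  have e1 : ∀ τ, (Lp.compMeasurePreserving (g τ) (hgm τ) (hF.toLp F) : ℝ × Y → ℝ) =ᵐ[volume]
      fun z => F (z.1 - τ, z.2) := fun τ =>
    (Lp.coeFn_compMeasurePreserving _ (hgm τ)).trans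
      ((hgm τ).quasiMeasurePreserving.ae_eq_comp hF.coeFn_toLp)
  filter_upwards [e1 σ, e1 0] with z hz hz0
  simp only [Pi.sub_apply, hz, hz0, sub_zero]

theorem tendsto_integral_timeShift_mul {p q : ℝ≥0∞} [hpq : ENNReal.HolderConjugate q p]
    (hq1 : 1 ≤ q) (hq : q ≠ ⊤) {A D : ℝ × Y → ℝ} (hA : MemLp A q volume) (hD : MemLp D p volume) :
    Filter.Tendsto (fun σ : ℝ => ∫ z : ℝ × Y, A (z.1 - σ, z.2) * D z) (nhds 0)
      (nhds (∫ z, A z * D z)) := by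
  have hs : ∀ σ : ℝ, MemLp (fun z : ℝ × Y => A (z.1 - σ, z.2)) q volume := fun σ =>
    hA.comp_measurePreserving (measurePreserving_timeShift σ)
  rw [tendsto_iff_dist_tendsto_zero]
  have h1 : Filter.Tendsto (fun σ : ℝ =>
      (eLpNorm (fun z : ℝ × Y => A (z.1 - σ, z.2) - A z) q volume * eLpNorm D p volume).toReal)
      (nhds 0) (nhds 0) := by
    have := ENNReal.Tendsto.mul_const (tendsto_eLpNorm_timeShift_sub hq1 hq hA)
      (Or.inr hD.2.ne)
    rw [zero_mul] at this
    exact (ENNReal.tendsto_toReal ENNReal.zero_ne_top).comp this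
  refine squeeze_zero (fun _ => dist_nonneg) (fun σ => ?_) h1
  have h2 : (∫ z : ℝ × Y, A (z.1 - σ, z.2) * D z) - ∫ z, A z * D z =
      ∫ z : ℝ × Y, (A (z.1 - σ, z.2) - A z) * D z := by
    simp only [sub_mul]
    exact (integral_sub ((hs σ).integrable_mul hD) (hA.integrable_mul hD)).symm
  rw [Real.dist_eq, h2]
  exact abs_integral_mul_le ((hs σ).sub hA) hD

/-- From a one-sided difference inequality on all short intervals `[t-h,t]`, in which the second
factor is frozen at the right endpoint `t`, to the integrated inequality. The difference inequality
is integrated in `t`; since time translations are continuous in `L^q`, the frozen factor can be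
unfrozen as `h → 0`. -/
theorem energy_le_of_backward_difference {p q : ℝ≥0∞} [hpq : ENNReal.HolderConjugate q p]
    (hq1 : 1 ≤ q) (hq : q ≠ ⊤) {A D : ℝ × Y → ℝ} (hA : MemLp A q volume) (hD : MemLp D p volume)
    {E : ℝ → ℝ} (hE : Continuous E) {a b η : ℝ} (hab : a ≤ b) (hη : 0 < η)
    (hd : ∀ᵐ t, t ∈ Icc a b → ∀ h, 0 < h → h ≤ η →
      E t - E (t - h) ≤ -∫ τ in (t - h)..t, ∫ y, A (τ, y) * D (t, y)) :
    E b - E a ≤ -∫ t in Icc a b, ∫ y, A (t, y) * D (t, y) := by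
  set D1 : ℝ × Y → ℝ := (Icc a b ×ˢ univ).indicator D with hD1
  have hms : MeasurableSet (Icc a b ×ˢ (univ : Set Y)) := measurableSet_Icc.prod .univ
  have hD1L : MemLp D1 p volume := hD.indicator hms
  set c : ℝ → ℝ := fun σ => ∫ z : ℝ × Y, A (z.1 - σ, z.2) * D1 z with hc
  have hc0 : ∀ σ, c σ = ∫ t in Icc a b, ∫ y, A (t - σ, y) * D (t, y) := by
    intro σ
    have hi : Integrable (fun z : ℝ × Y => A (z.1 - σ, z.2) * D1 z) volume :=
      (hA.comp_measurePreserving (measurePreserving_timeShift (Y := Y) σ)).integrable_mul hD1L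
    rw [hc]
    simp only
    rw [Measure.volume_eq_prod, integral_prod _ hi, ← integral_indicator measurableSet_Icc]
    congr 1; ext t
    by_cases ht : t ∈ Icc a b
    · simp [hD1, ht]
    · simp [hD1, ht]
  have hcont : Filter.Tendsto c (nhds 0) (nhds (∫ z, A z * D1 z)) :=
    tendsto_integral_timeShift_mul hq1 hq hA hD1L
  have hc00 : c 0 = ∫ z, A z * D1 z := by simp [hc]
  rw [← hc00] at hcont
  have hgoal : ∫ t in Icc a b, ∫ y, A (t, y) * D (t, y) = c 0 := by simp [hc0]
  rw [hgoal]
  -- the difference inequality integrated over `t ∈ [a,b]`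
  have hint : ∀ h, 0 < h → h ≤ η →
      ∫ t in a..b, (E t - E (t - h)) ≤ -∫ σ in Icc 0 h, c σ := by
    intro h h0 hhη
    have h3 := integrable_timeShift_mul hA hD1L h
    -- integrability over `[0,h] × ℝ` of the integrand after integration over `Y`
    have h4 : Integrable (fun w : ℝ × ℝ => ∫ y, A (w.2 - w.1, y) * D1 (w.2, y))
        ((volume.restrict (Icc 0 h)).prod volume) := by
      have e := (measurePreserving_prodAssoc (volume.restrict (Icc 0 h)) (volume : Measure ℝ)
        (volume : Measure Y))
      have h5 := (e.integrable_comp_of_integrable h3).integral_prod_left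
      exact h5
    have h6 : ∫ σ in Icc 0 h, c σ =
        ∫ t, ∫ σ in Icc 0 h, ∫ y, A (t - σ, y) * D1 (t, y) := by
      refine Eq.trans ?_ (integral_integral_swap
        (f := fun σ t => ∫ y, A (t - σ, y) * D1 (t, y)) h4)
      refine integral_congr_ae ?_
      filter_upwards [h3.prod_right_ae] with σ hσ
      rw [hc]
      simp only
      rw [Measure.volume_eq_prod, integral_prod _ hσ]
    have h7 : ∫ t, ∫ σ in Icc 0 h, ∫ y, A (t - σ, y) * D1 (t, y) =
        ∫ t in Icc a b, ∫ σ in Icc 0 h, ∫ y, A (t - σ, y) * D1 (t, y) := by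
      refine (setIntegral_eq_integral_of_forall_compl_eq_zero fun t ht => ?_).symm
      simp [hD1, ht]
    rw [h6, h7, intervalIntegral.integral_of_le hab, ← integral_Icc_eq_integral_Ioc, ← integral_neg]
    refine integral_mono_ae ?_ ?_ ?_
    · exact (Continuous.integrableOn_Icc (by fun_prop))
    · exact (h4.integral_prod_right.restrict).neg
    · filter_upwards [ae_restrict_of_ae hd, ae_restrict_mem measurableSet_Icc] with t ht htm
      refine (ht htm h h0 hhη).trans_eq ?_
      have := intervalIntegral.integral_comp_sub_left (a := 0) (b := h)
        (fun τ => ∫ y, A (τ, y) * D (t, y)) t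
      rw [sub_zero] at this
      rw [← this, intervalIntegral.integral_of_le h0.le, ← integral_Icc_eq_integral_Ioc]
      simp [hD1, htm]
  refine le_of_forall_pos_le_add fun ε hε => ?_
  have hε3 : 0 < ε / 3 := by positivity
  obtain ⟨δ1, hδ1, hcδ⟩ := Metric.tendsto_nhds_nhds.1 hcont (ε / 3) hε3
  obtain ⟨δ2, hδ2, hEb⟩ := Metric.continuous_iff.1 hE b (ε / 3) hε3
  obtain ⟨δ3, hδ3, hEa⟩ := Metric.continuous_iff.1 hE a (ε / 3) hε3
  set h := min η (min δ1 (min δ2 δ3)) / 2 with hh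
  have hm0 : 0 < min η (min δ1 (min δ2 δ3)) := by positivity
  have h0 : 0 < h := by positivity
  have hlt : h < min η (min δ1 (min δ2 δ3)) := by rw [hh]; linarith
  simp only [lt_min_iff] at hlt
  obtain ⟨l0, l1, l2, l3⟩ := hlt
  have hI := hint h h0 l0.le
  have hEi : ∀ x y : ℝ, IntervalIntegrable E volume x y := fun x y => hE.intervalIntegrable x y
  have htel : ∫ t in a..b, (E t - E (t - h)) =
      (∫ t in (b - h)..b, E t) - ∫ t in (a - h)..a, E t := by
    rw [intervalIntegral.integral_sub (hEi _ _) (Continuous.intervalIntegrable (by fun_prop) _ _),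
      intervalIntegral.integral_comp_sub_right E h]
    have := intervalIntegral.integral_interval_sub_interval_comm (hEi a b) (hEi (a - h) (b - h))
      (hEi a (a - h))
    rw [this, intervalIntegral.integral_symm (a - h) a, intervalIntegral.integral_symm (b - h) b]
    ring
  have hb : h * (E b - ε / 3) ≤ ∫ t in (b - h)..b, E t := by
    have := intervalIntegral.integral_mono_on (by linarith : b - h ≤ b)
      (continuous_const.intervalIntegrable (μ := volume) _ _) (hEi (b - h) b)
      (fun x hx => ?_ : ∀ x ∈ Icc (b - h) b, E b - ε / 3 ≤ E x)
    · simpa only [intervalIntegral.integral_const, sub_sub_cancel, smul_eq_mul] using this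
    · have := hEb x (by rw [Real.dist_eq, abs_lt]; constructor <;> linarith [hx.1, hx.2])
      rw [Real.dist_eq, abs_lt] at this
      linarith
  have ha : ∫ t in (a - h)..a, E t ≤ h * (E a + ε / 3) := by
    have := intervalIntegral.integral_mono_on (by linarith : a - h ≤ a) (hEi (a - h) a)
      (continuous_const.intervalIntegrable (μ := volume) _ _)
      (fun x hx => ?_ : ∀ x ∈ Icc (a - h) a, E x ≤ E a + ε / 3)
    · simpa only [intervalIntegral.integral_const, sub_sub_cancel, smul_eq_mul] using this
    · have := hEa x (by rw [Real.dist_eq, abs_lt]; constructor <;> linarith [hx.1, hx.2])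
      rw [Real.dist_eq, abs_lt] at this
      linarith
  have hcc : h * (c 0 - ε / 3) ≤ ∫ σ in Icc 0 h, c σ := by
    have hci : IntegrableOn c (Icc 0 h) := (integrable_timeShift_mul hA hD1L h).integral_prod_left
    have := setIntegral_mono_on (integrableOn_const (by simp)) hci measurableSet_Icc
      (fun x hx => ?_ : ∀ x ∈ Icc 0 h, c 0 - ε / 3 ≤ c x)
    · simpa [h0.le] using this
    · have := @hcδ x (by rw [Real.dist_eq, abs_lt]; constructor <;> linarith [hx.1, hx.2])
      rw [Real.dist_eq, abs_lt] at this
      linarith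
  have : h * (E b - E a) ≤ h * (-c 0 + ε) := by nlinarith
  exact le_of_mul_le_mul_left this h0

end energy

/-- Grönwall's inequality in integrated form. The energy is nonincreasing, so that
`(1 + κ δ) E(t + δ) ≤ E(t)`; iterating this over `N` equal steps and letting `N → ∞` gives the
exponential. -/
theorem le_mul_exp_of_sub_le {E : ℝ → ℝ} (hE : Continuous E) (hE0 : ∀ t, 0 ≤ E t) {κ a b : ℝ}
    (hκ : 0 ≤ κ) (hab : a ≤ b)
    (h : ∀ s t, a ≤ s → s ≤ t → t ≤ b → E t - E s ≤ -(κ * ∫ r in Icc s t, E r)) :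
    E b ≤ E a * Real.exp (-(κ * (b - a))) := by
  have hmono : ∀ s t, a ≤ s → s ≤ t → t ≤ b → E t ≤ E s := fun s t h1 h2 h3 => by
    have := h s t h1 h2 h3
    have h4 : 0 ≤ ∫ r in Icc s t, E r := integral_nonneg fun r => hE0 r
    nlinarith
  have hstep : ∀ s t, a ≤ s → s ≤ t → t ≤ b → (1 + κ * (t - s)) * E t ≤ E s :=
    fun s t h1 h2 h3 => by
    have h4 := h s t h1 h2 h3
    have h5 : (t - s) * E t ≤ ∫ r in Icc s t, E r := by
      have := setIntegral_mono_on (integrableOn_const (by simp))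
        (hE.integrableOn_Icc (μ := volume) (a := s) (b := t)) measurableSet_Icc
        (fun x hx => hmono x t (h1.trans hx.1) hx.2 h3 : ∀ x ∈ Icc s t, E t ≤ E x)
      simpa [h2] using this
    nlinarith
  have hiter : ∀ N : ℕ, 0 < N → (1 + κ * (b - a) / N) ^ N * E b ≤ E a := by
    intro N hN
    have hN' : (0 : ℝ) < N := by exact_mod_cast hN
    have hba : 0 ≤ b - a := by linarith
    have : ∀ i : ℕ, i ≤ N → (1 + κ * (b - a) / N) ^ i * E (a + i * ((b - a) / N)) ≤ E a := by
      intro i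
      induction i with
      | zero => simp
      | succ i ih =>
        intro hi
        have h1 := ih (by omega)
        have hiN : ((i : ℝ) + 1) ≤ N := by exact_mod_cast hi
        have hdiv : 0 ≤ (b - a) / N := by positivity
        have h2 := hstep (a + i * ((b - a) / N)) (a + (i + 1 : ℕ) * ((b - a) / N))
          (by have : (0 : ℝ) ≤ i * ((b - a) / N) := by positivity
              linarith)
          (by push_cast; linarith) (by
            have : ((i : ℝ) + 1) * ((b - a) / N) ≤ N * ((b - a) / N) := by gcongr
            rw [mul_div_cancel₀ _ hN'.ne'] at this
            push_cast; linarith)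
        have e : 1 + κ * (a + (i + 1 : ℕ) * ((b - a) / N) - (a + i * ((b - a) / N))) =
            1 + κ * (b - a) / N := by push_cast; ring
        rw [e] at h2
        have h3 : 0 ≤ (1 + κ * (b - a) / N) ^ i := by positivity
        rw [pow_succ, mul_assoc]
        exact (mul_le_mul_of_nonneg_left h2 h3).trans h1
    have h2 := this N le_rfl
    rwa [mul_div_cancel₀ _ hN'.ne', add_sub_cancel] at h2
  have hlim := (Real.tendsto_one_add_div_pow_exp (κ * (b - a))).mul_const (E b)
  have hle : Real.exp (κ * (b - a)) * E b ≤ E a :=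
    le_of_tendsto hlim ((Filter.eventually_gt_atTop 0).mono hiter)
  rw [Real.exp_neg, ← div_eq_mul_inv, le_div_iff₀ (Real.exp_pos _), mul_comm]
  exact hle

/-! ### Coercivity of the difference of two fractional `p`-Laplacians -/

variable {n : ℕ} {s p : ℝ}

theorem aemeasurable_enorm_sub_dmu {f : Rn n → ℝ} (hf : AEStronglyMeasurable f volume) :
    AEMeasurable (fun z : Rn n × Rn n => ‖f z.1 - f z.2‖ₑ) (dmu n s p) :=
  (aestronglyMeasurable_sub_prod hf).enorm.mono_ac (dmu_absolutelyContinuous n s p)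

/-- Hölder's inequality with exponents `2/p` and `2/(2-p)`, which bounds the seminorm of `∫₀ʷ h` by
the weighted quadratic form with the singular weight `(|δu|+|δv|)^(p-2)`. -/
theorem wspSeminorm_sq_le (hp : 1 < p) (hp2 : p < 2) {u v G : Rn n → ℝ}
    (hu : AEStronglyMeasurable u volume) (hv : AEStronglyMeasurable v volume)
    (hG : AEStronglyMeasurable G volume)
    (h0 : ∀ x y, |u x - u y| + |v x - v y| = 0 → G x = G y) :
    wspSeminorm s p univ G ^ (2 : ℝ) ≤
      (∫⁻ z : Rn n × Rn n, ENNReal.ofReal ((|u z.1 - u z.2| + |v z.1 - v z.2|) ^ (p - 2) *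
        (G z.1 - G z.2) ^ 2) ∂(dmu n s p)) *
      (wspSeminorm s p univ v + wspSeminorm s p univ u) ^ (2 - p) := by
  have hp0 : 0 < p := by linarith
  have hp2' : 0 < 2 - p := by linarith
  set R : Rn n × Rn n → ℝ := fun z => |u z.1 - u z.2| + |v z.1 - v z.2| with hR
  have hR0 : ∀ z, 0 ≤ R z := fun z => by positivity
  set Q : Rn n × Rn n → ℝ≥0∞ := fun z =>
    ENNReal.ofReal (R z ^ (p - 2) * (G z.1 - G z.2) ^ 2) with hQ
  have hRe : ∀ z, ENNReal.ofReal (R z) = ‖v z.1 - v z.2‖ₑ + ‖u z.1 - u z.2‖ₑ := fun z => by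
    rw [hR, ENNReal.ofReal_add (abs_nonneg _) (abs_nonneg _), Real.enorm_eq_ofReal_abs,
      Real.enorm_eq_ofReal_abs, add_comm]
  have hac := dmu_absolutelyContinuous n s p
  have hRm : AEMeasurable R (dmu n s p) :=
    (((aestronglyMeasurable_sub_prod hu).norm.add
      (aestronglyMeasurable_sub_prod hv).norm).mono_ac hac).aemeasurable
  have hGm : AEMeasurable (fun z : Rn n × Rn n => G z.1 - G z.2) (dmu n s p) :=
    ((aestronglyMeasurable_sub_prod hG).mono_ac hac).aemeasurable
  have hQm : AEMeasurable Q (dmu n s p) :=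
    ((hRm.pow_const (p - 2)).mul (hGm.pow_const 2)).ennreal_ofReal
  have hpt : ∀ z : Rn n × Rn n, ‖G z.1 - G z.2‖ₑ ^ p =
      Q z ^ (p / 2) * (ENNReal.ofReal (R z) ^ p) ^ ((2 - p) / 2) := by
    intro z
    rcases (hR0 z).eq_or_lt with hz | hz
    · have hGz : G z.1 = G z.2 := h0 _ _ hz.symm
      simp [hQ, hGz, hp0]
    · rw [hQ]
      simp only
      rw [← ENNReal.rpow_mul, ENNReal.ofReal_rpow_of_nonneg (by positivity) (by positivity),
        ENNReal.ofReal_rpow_of_pos hz, ← ENNReal.ofReal_mul (by positivity),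
        Real.enorm_eq_ofReal_abs, ENNReal.ofReal_rpow_of_nonneg (abs_nonneg _) hp0.le,
        Real.mul_rpow (by positivity) (by positivity), ← Real.rpow_mul hz.le, ← sq_abs,
        ← Real.rpow_natCast, ← Real.rpow_mul (abs_nonneg _), mul_right_comm, ← Real.rpow_add hz,
        show (p - 2) * (p / 2) + p * ((2 - p) / 2) = 0 by ring, Real.rpow_zero, one_mul]
      congr 2
      push_cast; ring
  have hconj : (2 / p).HolderConjugate (2 / (2 - p)) := by
    rw [Real.holderConjugate_iff]
    constructor
    · rw [lt_div_iff₀ hp0]; linarith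
    · field_simp; ring
  have h1 := ENNReal.lintegral_mul_le_Lp_mul_Lq (dmu n s p) hconj (hQm.pow_const (p / 2))
    ((hRm.ennreal_ofReal.pow_const p).pow_const ((2 - p) / 2))
  simp only [Pi.mul_apply, ← hpt] at h1
  rw [← wspSeminorm_rpow hp0] at h1
  have e1 : ∀ x : ℝ≥0∞, (x ^ (p / 2)) ^ (2 / p) = x := fun x => by
    rw [← ENNReal.rpow_mul, show p / 2 * (2 / p) = 1 by field_simp, ENNReal.rpow_one]
  have e2 : ∀ x : ℝ≥0∞, (x ^ ((2 - p) / 2)) ^ (2 / (2 - p)) = x := fun x => by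
    rw [← ENNReal.rpow_mul, show (2 - p) / 2 * (2 / (2 - p)) = 1 by field_simp, ENNReal.rpow_one]
  simp only [e1, e2, one_div_div] at h1
  have hmink : (∫⁻ z, ENNReal.ofReal (R z) ^ p ∂(dmu n s p)) ≤
      (wspSeminorm s p univ v + wspSeminorm s p univ u) ^ p := by
    have h2 := ENNReal.lintegral_Lp_add_le (aemeasurable_enorm_sub_dmu (s := s) (p := p) hv)
      (aemeasurable_enorm_sub_dmu hu) hp.le
    simp only [Pi.add_apply, ← hRe] at h2
    have h3 := ENNReal.rpow_le_rpow h2 hp0.le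
    rw [← ENNReal.rpow_mul, one_div_mul_cancel hp0.ne', ENNReal.rpow_one] at h3
    simpa [wspSeminorm] using h3
  have h4 := ENNReal.rpow_le_rpow (h1.trans (mul_le_mul_right
    (ENNReal.rpow_le_rpow hmink (by positivity)) _)) (z := 2 / p) (by positivity)
  rw [← ENNReal.rpow_mul, mul_div_cancel₀ _ hp0.ne', ENNReal.mul_rpow_of_nonneg _ _ (by positivity),
    e1, ← ENNReal.rpow_mul, ← ENNReal.rpow_mul,
    show p * ((2 - p) / 2 * (2 / p)) = 2 - p by field_simp] at h4
  exact h4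

/-- The integrand of `⟨(-Δ_p)^s u - (-Δ_p)^s v, ψ⟩`. -/
noncomputable def diffForm (p : ℝ) (u v ψ : Rn n → ℝ) (z : Rn n × Rn n) : ℝ :=
  (Jp p (u z.1 - u z.2) - Jp p (v z.1 - v z.2)) * (ψ z.1 - ψ z.2)

/-- Pointwise coercivity of the difference form tested with `∫₀ʷ h²`. -/
theorem weight_mul_sq_le_diffForm_prim (hp : 1 < p) (hp2 : p < 2) {h : ℝ → ℝ} (hc : Continuous h)
    (u v : Rn n → ℝ) (z : Rn n × Rn n) :
    (p - 1) * ((|u z.1 - u z.2| + |v z.1 - v z.2|) ^ (p - 2) *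
      (prim h (u z.1 - v z.1) - prim h (u z.2 - v z.2)) ^ 2) ≤
    diffForm p u v (fun x => prim (fun t => h t ^ 2) (u x - v x)) z :=
  Jp_sub_mul_prim_sub_ge hp hp2 hc (by ring)

/-- Coercivity: testing the difference of the two operators with `∫₀ʷ h²`, where `w = u - v`,
controls the energy `∫_Ω ∫₀ʷ∫₀ʳ h²`. -/
theorem energy_le_integral_diffForm (hp : 1 < p) (hp2 : p < 2) {Ω : Set (Rn n)} {C : ℝ}
    (hC : 0 < C)
    (hSob : ∀ f : Rn n → ℝ, AEStronglyMeasurable f volume →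
      (∀ᵐ x, x ∉ Ω → f x = 0) → ∫⁻ x in Ω, ‖f x‖ₑ ^ (2 : ℝ) ≠ ⊤ →
      ∫⁻ x in Ω, ‖f x‖ₑ ^ (2 : ℝ) ≤ ENNReal.ofReal C * wspSeminorm s p univ f ^ (2 : ℝ))
    {h : ℝ → ℝ} (hc : Continuous h) (h0 : ∀ t, 0 ≤ h t) (he : ∀ t, h (-t) = h t)
    (hm : MonotoneOn h (Ici 0)) {H : ℝ} (hH : ∀ t, h t ≤ H) {u v : Rn n → ℝ}
    (hu : AEStronglyMeasurable u volume) (hv : AEStronglyMeasurable v volume)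
    (hw0 : ∀ᵐ x, x ∉ Ω → u x - v x = 0)
    (hw2 : MemLp (fun x => u x - v x) 2 (volume.restrict Ω))
    (hint : Integrable (diffForm p u v (fun x => prim (fun t => h t ^ 2) (u x - v x)))
      (dmu n s p)) :
    ENNReal.ofReal (2 * ∫ x in Ω, prim (prim fun t => h t ^ 2) (u x - v x)) ≤
      ENNReal.ofReal (C / (p - 1) *
        ∫ z, diffForm p u v (fun x => prim (fun t => h t ^ 2) (u x - v x)) z ∂(dmu n s p)) *
      (wspSeminorm s p univ v + wspSeminorm s p univ u) ^ (2 - p) := by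
  have hp1 : 0 < p - 1 := by linarith
  set G : Rn n → ℝ := fun x => prim h (u x - v x) with hG
  have hGc := continuous_prim hc
  have hGm : AEStronglyMeasurable G volume := hGc.comp_aestronglyMeasurable (hu.sub hv)
  have hGb : ∀ t, |prim h t| ≤ H * |t| := fun t => by
    have := abs_prim_sub_le hc (H := H) (fun t => by rw [abs_of_nonneg (h0 t)]; exact hH t) t 0
    simpa [prim_zero] using this
  have hG2 : MemLp G 2 (volume.restrict Ω) :=
    hw2.of_le_mul (c := H) hGm.restrict (Filter.Eventually.of_forall fun x => hGb _)
  have hG2' : ∫⁻ x in Ω, ‖G x‖ₑ ^ (2 : ℝ) ≠ ⊤ := by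
    have := (lintegral_rpow_enorm_lt_top_of_eLpNorm_lt_top two_ne_zero ENNReal.ofNat_ne_top hG2.2).ne
    simpa using this
  have hG0 : ∀ᵐ x, x ∉ Ω → G x = 0 := by
    filter_upwards [hw0] with x hx hxΩ
    simp [hG, hx hxΩ, prim_zero]
  have hS := hSob G hGm hG0 hG2'
  have hQ := wspSeminorm_sq_le (s := s) hp hp2 hu hv hGm (fun x y hxy => by
    have h1 : u x - u y = 0 := by
      have := abs_nonneg (v x - v y); have := abs_nonneg (u x - u y)
      exact abs_eq_zero.1 (by linarith)
    have h2 : v x - v y = 0 := by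
      have := abs_nonneg (v x - v y); have := abs_nonneg (u x - u y)
      exact abs_eq_zero.1 (by linarith)
    simp only [hG]
    congr 1; linarith)
  have hF0 : ∀ z, 0 ≤ diffForm p u v (fun x => prim (fun t => h t ^ 2) (u x - v x)) z := fun z =>
    le_trans (by positivity) (weight_mul_sq_le_diffForm_prim hp hp2 hc u v z)
  have hle : ∫⁻ z : Rn n × Rn n, ENNReal.ofReal ((|u z.1 - u z.2| + |v z.1 - v z.2|) ^ (p - 2) *
        (G z.1 - G z.2) ^ 2) ∂(dmu n s p) ≤ ENNReal.ofReal ((p - 1)⁻¹ *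
        ∫ z, diffForm p u v (fun x => prim (fun t => h t ^ 2) (u x - v x)) z ∂(dmu n s p)) := by
    rw [← integral_const_mul, ofReal_integral_eq_lintegral_ofReal (hint.const_mul _)
      (Filter.Eventually.of_forall fun z => mul_nonneg (by positivity) (hF0 z))]
    refine lintegral_mono fun z => ENNReal.ofReal_le_ofReal ?_
    rw [← div_eq_inv_mul, le_div_iff₀' hp1]
    exact weight_mul_sq_le_diffForm_prim hp hp2 hc u v z
  have hE : ENNReal.ofReal (2 * ∫ x in Ω, prim (prim fun t => h t ^ 2) (u x - v x)) ≤
      ∫⁻ x in Ω, ‖G x‖ₑ ^ (2 : ℝ) := by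
    have hsq : ∀ x, ‖G x‖ₑ ^ (2 : ℝ) = ENNReal.ofReal (G x ^ 2) := fun x => by
      rw [Real.enorm_eq_ofReal_abs, ENNReal.ofReal_rpow_of_nonneg (abs_nonneg _) zero_le_two]
      norm_num
    simp only [hsq]
    rw [← ofReal_integral_eq_lintegral_ofReal hG2.integrable_sq
      (Filter.Eventually.of_forall fun x => sq_nonneg _), ← integral_const_mul]
    refine ENNReal.ofReal_le_ofReal (integral_mono_of_nonneg ?_ hG2.integrable_sq ?_)
    · refine Filter.Eventually.of_forall fun x => mul_nonneg zero_le_two ?_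
      exact prim_nonneg_of_monotone (continuous_prim (hc.pow 2))
        (monotone_prim (hc.pow 2) fun _ => sq_nonneg _) (prim_zero _) _
    · exact Filter.Eventually.of_forall fun x => two_mul_prim_prim_sq_le hc h0 he hm _
  refine hE.trans (hS.trans ?_)
  calc ENNReal.ofReal C * wspSeminorm s p univ G ^ (2 : ℝ)
      ≤ ENNReal.ofReal C * (ENNReal.ofReal ((p - 1)⁻¹ *
        ∫ z, diffForm p u v (fun x => prim (fun t => h t ^ 2) (u x - v x)) z ∂(dmu n s p)) *
      (wspSeminorm s p univ v + wspSeminorm s p univ u) ^ (2 - p)) := by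
        gcongr
        exact hQ.trans (mul_le_mul_left hle _)
    _ = _ := by
        rw [← mul_assoc, ← ENNReal.ofReal_mul hC.le, div_eq_mul_inv, mul_assoc C]

/-! ### Weighted difference quotients -/

/-- `(f(x)-f(y)) |x-y|^(-(n+sp)/p)`, whose norm in `L^p(ℝⁿ × ℝⁿ)` for Lebesgue measure is
`[f]_{W^{s,p}(ℝⁿ)}`. -/
noncomputable def diffQuot (s p : ℝ) (f : Rn n → ℝ) (z : Rn n × Rn n) : ℝ :=
  (f z.1 - f z.2) * (‖z.1 - z.2‖ ^ (-((n : ℝ) + s * p))) ^ (1 / p)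

/-- The difference quotients of a curve of functions, extended by zero to times outside `J`. -/
noncomputable def diffQuotTime (s p : ℝ) (J : Set ℝ) (u : ℝ → Rn n → ℝ)
    (w : ℝ × (Rn n × Rn n)) : ℝ :=
  (J ×ˢ univ).indicator (fun w => diffQuot s p (u w.1) w.2) w

theorem diffQuotTime_of_mem {J : Set ℝ} {t : ℝ} (ht : t ∈ J) (u : ℝ → Rn n → ℝ)
    (z : Rn n × Rn n) : diffQuotTime s p J u (t, z) = diffQuot s p (u t) z := by
  simp [diffQuotTime, ht]

theorem measurable_kernelRoot : Measurable fun z : Rn n × Rn n =>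
    (‖z.1 - z.2‖ ^ (-((n : ℝ) + s * p))) ^ (1 / p) := by fun_prop

theorem enorm_diffQuot_rpow (hp : 0 < p) (f : Rn n → ℝ) (z : Rn n × Rn n) :
    ‖diffQuot s p f z‖ₑ ^ p =
      ENNReal.ofReal (‖z.1 - z.2‖ ^ (-((n : ℝ) + s * p))) * ‖f z.1 - f z.2‖ₑ ^ p := by
  have h0 : 0 ≤ ‖z.1 - z.2‖ ^ (-((n : ℝ) + s * p)) := by positivity
  rw [diffQuot, enorm_mul, ENNReal.mul_rpow_of_nonneg _ _ hp.le, mul_comm,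
    Real.enorm_of_nonneg (by positivity : (0 : ℝ) ≤ (‖z.1 - z.2‖ ^ (-((n : ℝ) + s * p))) ^ (1 / p)),
    ENNReal.ofReal_rpow_of_nonneg (by positivity) hp.le, ← Real.rpow_mul h0,
    one_div_mul_cancel hp.ne', Real.rpow_one]

theorem lintegral_diffQuot (hp : 0 < p) (f : Rn n → ℝ) :
    ∫⁻ z, ‖diffQuot s p f z‖ₑ ^ p = wspSeminorm s p univ f ^ p := by
  rw [wspSeminorm_rpow hp, dmu, lintegral_withDensity_eq_lintegral_mul_non_measurable _
    (measurable_kernel n s p) (by simp)]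
  simp only [Pi.mul_apply, enorm_diffQuot_rpow hp]

theorem memLp_ofReal_iff {α : Type*} [MeasurableSpace α] {μ : Measure α} (hp : 0 < p) {f : α → ℝ} :
    MemLp f (ENNReal.ofReal p) μ ↔ AEStronglyMeasurable f μ ∧ ∫⁻ x, ‖f x‖ₑ ^ p ∂μ < ⊤ := by
  rw [MemLp, eLpNorm_lt_top_iff_lintegral_rpow_enorm_lt_top
    (by simpa using hp) ENNReal.ofReal_ne_top, ENNReal.toReal_ofReal hp.le]

/-- `J_p` is homogeneous of degree `p - 1`, so that the kernel `|x-y|^(-n-sp)` is distributed over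
the two factors in such a way that they lie in `L^(p')` and `L^p`. -/
theorem Jp_diffQuot_mul (hp : 1 < p) (f g : Rn n → ℝ) (z : Rn n × Rn n) :
    Jp p (diffQuot s p f z) * diffQuot s p g z =
      ‖z.1 - z.2‖ ^ (-((n : ℝ) + s * p)) * (Jp p (f z.1 - f z.2) * (g z.1 - g z.2)) := by
  set c := ‖z.1 - z.2‖ ^ (-((n : ℝ) + s * p)) with hc
  have h0 : 0 ≤ c := by positivity
  rcases h0.eq_or_lt with h | h
  · have hp' : 1 / p ≠ 0 := by
      have : 0 < p := by linarith
      positivity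
    rw [diffQuot, diffQuot, ← hc, ← h, Real.zero_rpow hp']
    simp
  · have hk : 0 < c ^ (1 / p) := by positivity
    rw [diffQuot, diffQuot, ← hc, Jp, Jp, abs_mul, abs_of_pos hk,
      Real.mul_rpow (abs_nonneg _) hk.le, ← Real.rpow_mul h.le]
    have : c ^ (1 / p * (p - 2)) * c ^ (1 / p) * c ^ (1 / p) = c := by
      rw [← Real.rpow_add h, ← Real.rpow_add h]
      have : 1 / p * (p - 2) + 1 / p + 1 / p = 1 := by
        have : p ≠ 0 := by linarith
        field_simp; ring
      rw [this, Real.rpow_one]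
    calc _ = (c ^ (1 / p * (p - 2)) * c ^ (1 / p) * c ^ (1 / p)) *
        (|f z.1 - f z.2| ^ (p - 2) * (f z.1 - f z.2) * (g z.1 - g z.2)) := by ring
      _ = _ := by rw [this]

theorem integral_dmu (F : Rn n × Rn n → ℝ) :
    ∫ z, F z ∂(dmu n s p) = ∫ z, ‖z.1 - z.2‖ ^ (-((n : ℝ) + s * p)) * F z := by
  rw [dmu, integral_withDensity_eq_integral_toReal_smul (measurable_kernel n s p) (by simp)]
  refine integral_congr_ae (Filter.Eventually.of_forall fun z => ?_)
  simp only [smul_eq_mul]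
  rw [ENNReal.toReal_ofReal (by positivity)]

theorem integrable_dmu_iff (F : Rn n × Rn n → ℝ) : Integrable F (dmu n s p) ↔
    Integrable (fun z : Rn n × Rn n => ‖z.1 - z.2‖ ^ (-((n : ℝ) + s * p)) * F z) volume := by
  rw [dmu, integrable_withDensity_iff_integrable_smul' (measurable_kernel n s p) (by simp)]
  refine integrable_congr (Filter.Eventually.of_forall fun z => ?_)
  simp only [smul_eq_mul]
  rw [ENNReal.toReal_ofReal (by positivity)]

theorem integral_Jp_diffQuot_mul (hp : 1 < p) (f g : Rn n → ℝ) :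
    ∫ z, Jp p (diffQuot s p f z) * diffQuot s p g z =
      ∫ z : Rn n × Rn n, Jp p (f z.1 - f z.2) * (g z.1 - g z.2) ∂(dmu n s p) := by
  simp only [Jp_diffQuot_mul hp, integral_dmu]

theorem diffForm_eq_diffQuot (hp : 1 < p) (u v ψ : Rn n → ℝ) (z : Rn n × Rn n) :
    ‖z.1 - z.2‖ ^ (-((n : ℝ) + s * p)) * diffForm p u v ψ z =
      (Jp p (diffQuot s p u z) - Jp p (diffQuot s p v z)) * diffQuot s p ψ z := by
  rw [sub_mul, Jp_diffQuot_mul hp, Jp_diffQuot_mul hp, diffForm]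
  ring

theorem memLp_Jp {α : Type*} [MeasurableSpace α] {μ : Measure α} (hp : 1 < p) {X : α → ℝ}
    (hX : MemLp X (ENNReal.ofReal p) μ) :
    MemLp (fun z => Jp p (X z)) (ENNReal.ofReal (p / (p - 1))) μ := by
  have hp1 : 0 < p - 1 := by linarith
  have hp0 : 0 < p := by linarith
  rw [memLp_ofReal_iff hp0] at hX
  rw [memLp_ofReal_iff (by positivity)]
  refine ⟨((measurable_Jp p).comp_aemeasurable hX.1.aemeasurable).aestronglyMeasurable, ?_⟩
  have : ∀ z, ‖Jp p (X z)‖ₑ ^ (p / (p - 1)) = ‖X z‖ₑ ^ p := fun z => by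
    rw [Real.enorm_eq_ofReal_abs, abs_Jp hp, ← ENNReal.ofReal_rpow_of_nonneg (abs_nonneg _) hp1.le,
      ← ENNReal.rpow_mul, mul_div_cancel₀ _ hp1.ne', Real.enorm_eq_ofReal_abs]
  simpa only [this] using hX.2

theorem holderConjugate_ofReal (hp : 1 < p) :
    ENNReal.HolderConjugate (ENNReal.ofReal (p / (p - 1))) (ENNReal.ofReal p) := by
  have := (Real.HolderConjugate.conjExponent hp).symm
  exact this.ennrealOfReal

/-- Joint measurability passes to the difference quotients. -/
theorem aestronglyMeasurable_diffQuotTime {J : Set ℝ} (hJ : MeasurableSet J) {u : ℝ → Rn n → ℝ}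
    (hu : AEStronglyMeasurable (Function.uncurry u) ((volume.restrict J).prod volume)) :
    AEStronglyMeasurable (diffQuotTime s p J u) volume := by
  have hq1 : Measure.QuasiMeasurePreserving
      (fun w : ℝ × (Rn n × Rn n) => (w.1, w.2.1))
      ((volume.restrict J).prod volume) ((volume.restrict J).prod volume) :=
    QuasiMeasurePreserving.prodMap (.id _) Measure.quasiMeasurePreserving_fst
  have hq2 : Measure.QuasiMeasurePreserving
      (fun w : ℝ × (Rn n × Rn n) => (w.1, w.2.2))
      ((volume.restrict J).prod volume) ((volume.restrict J).prod volume) :=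
    QuasiMeasurePreserving.prodMap (.id _) Measure.quasiMeasurePreserving_snd
  have h1 : AEStronglyMeasurable (fun w : ℝ × (Rn n × Rn n) => diffQuot s p (u w.1) w.2)
      ((volume.restrict J).prod volume) :=
    ((hu.comp_quasiMeasurePreserving hq1).sub (hu.comp_quasiMeasurePreserving hq2)).mul
      (measurable_kernelRoot.comp measurable_snd).aestronglyMeasurable
  refine (aestronglyMeasurable_indicator_iff (hJ.prod .univ)).2 ?_
  rwa [Measure.volume_eq_prod, ← Measure.prod_restrict, Measure.restrict_univ]

/-- A curve that is bounded in `W^{s,p}(ℝⁿ)` has difference quotients in `L^p(ℝ × ℝ²ⁿ)`. -/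
theorem memLp_diffQuotTime (hp : 0 < p) {J : Set ℝ} (hJ : MeasurableSet J) (hJf : volume J ≠ ⊤)
    {u : ℝ → Rn n → ℝ}
    (hu : AEStronglyMeasurable (Function.uncurry u) ((volume.restrict J).prod volume))
    {M : ℝ≥0∞} (hM : M ≠ ⊤) (hb : ∀ᵐ t ∂(volume.restrict J), wspSeminorm s p univ (u t) ≤ M) :
    MemLp (diffQuotTime s p J u) (ENNReal.ofReal p) volume := by
  rw [memLp_ofReal_iff hp]
  have hm := aestronglyMeasurable_diffQuotTime (s := s) (p := p) hJ hu
  refine ⟨hm, ?_⟩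
  rw [Measure.volume_eq_prod, lintegral_prod _ (hm.enorm.pow_const p)]
  have h1 : ∫⁻ t, ∫⁻ z, ‖diffQuotTime s p J u (t, z)‖ₑ ^ p =
      ∫⁻ t in J, wspSeminorm s p univ (u t) ^ p := by
    rw [← lintegral_indicator hJ]
    refine lintegral_congr fun t => ?_
    by_cases ht : t ∈ J
    · simp only [diffQuotTime_of_mem ht, lintegral_diffQuot hp, indicator_of_mem ht]
    · simp [diffQuotTime, ht, hp]
  rw [h1]
  calc _ ≤ ∫⁻ _ in J, M ^ p := lintegral_mono_ae (by
        filter_upwards [hb] with t ht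
        gcongr)
    _ < ⊤ := by
        rw [setLIntegral_const]
        exact ENNReal.mul_lt_top (ENNReal.rpow_lt_top_of_nonneg hp.le hM) hJf.lt_top

/-! ### Test functions -/

theorem wspSeminorm_le_wspNorm (hp : 0 < p) (A : Set (Rn n)) (g : Rn n → ℝ) :
    wspSeminorm s p A g ≤ wspNorm s p A g := by
  calc wspSeminorm s p A g = (wspSeminorm s p A g ^ p) ^ (1 / p) := by
        rw [← ENNReal.rpow_mul, mul_one_div_cancel hp.ne', ENNReal.rpow_one]
    _ ≤ _ := by
        rw [wspNorm]
        gcongr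
        exact le_self_add

theorem lintegral_le_wspNorm_rpow (hp : 0 < p) (A : Set (Rn n)) (g : Rn n → ℝ) :
    ∫⁻ x in A, ‖g x‖ₑ ^ p ≤ wspNorm s p A g ^ p := by
  rw [wspNorm, ← ENNReal.rpow_mul, one_div_mul_cancel hp.ne', ENNReal.rpow_one]
  exact le_add_self

theorem ae_eq_zero_of_mem_Wsp0 (hp : 0 < p) {Ω : Set (Rn n)} (hΩ : MeasurableSet Ω)
    {g : Rn n → ℝ} (hg : g ∈ Wsp0 s p Ω) : ∀ᵐ x, x ∉ Ω → g x = 0 := by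
  have h0 : ∫⁻ x in Ωᶜ, ‖g x‖ₑ ^ p = 0 := by
    have hle : ∀ ε : ℝ≥0∞, 0 < ε → (∫⁻ x in Ωᶜ, ‖g x‖ₑ ^ p) ^ (1 / p) ≤ ε := by
      intro ε hε
      obtain ⟨ψ, -, -, hψ, hlt⟩ := hg.2 ε hε
      have h1 : ∫⁻ x in Ωᶜ, ‖g x‖ₑ ^ p ≤ wspNorm s p univ (fun x => g x - ψ x) ^ p := by
        refine le_trans ?_ (lintegral_le_wspNorm_rpow hp univ _)
        rw [Measure.restrict_univ]
        refine (setLIntegral_mono' hΩ.compl fun x hx => ?_).trans (setLIntegral_le_lintegral _ _)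
        rw [image_eq_zero_of_notMem_tsupport fun h => hx (hψ h), sub_zero]
      have h2 := ENNReal.rpow_le_rpow h1 (z := 1 / p) (by positivity)
      rw [← ENNReal.rpow_mul, mul_one_div_cancel hp.ne', ENNReal.rpow_one] at h2
      exact h2.trans hlt.le
    have := le_of_forall_gt_imp_ge_of_dense (a₂ := (0 : ℝ≥0∞)) hle
    rw [nonpos_iff_eq_zero, ENNReal.rpow_eq_zero_iff] at this
    rcases this with h | h
    · exact h.1
    · exact absurd h.2 (by have : 0 < 1 / p := by positivity
                           linarith)
  have hm : AEMeasurable (fun x => ‖g x‖ₑ ^ p) (volume.restrict Ωᶜ) := by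
    have := hg.1.1
    rw [Measure.restrict_univ] at this
    exact (this.restrict).enorm.pow_const p
  rw [lintegral_eq_zero_iff' hm, Filter.EventuallyEq, ae_restrict_iff' hΩ.compl] at h0
  filter_upwards [h0] with x hx hxΩ
  simpa [hp.ne', hp.le, hp] using hx hxΩ

/-- A Lipschitz function of an element of `W^{s,p}(ℝⁿ)` that vanishes outside `Ω` is an admissible
time-independent test function. -/
theorem comp_mem_X0 (hp : 1 < p) {Ω Ω' : Set (Rn n)} (hΩ : MeasurableSet Ω)
    (hΩb : Bornology.IsBounded Ω) {w : Rn n → ℝ} (hw : w ∈ Wsp s p univ)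
    (hw0 : ∀ᵐ x, x ∉ Ω → w x = 0) {g : ℝ → ℝ} {K : ℝ} (hK : 0 ≤ K)
    (hg0 : g 0 = 0) (hg : ∀ a b, |g a - g b| ≤ K * |a - b|) (hgc : Continuous g) :
    (fun x => g (w x)) ∈ X0 s p Ω Ω' := by
  have hp0 : 0 < p := by linarith
  have hwm : AEStronglyMeasurable w volume := by simpa using hw.1
  have hm : AEStronglyMeasurable (fun x => g (w x)) volume := hgc.comp_aestronglyMeasurable hwm
  have hgE : ∀ a b, ‖g a - g b‖ₑ ≤ ENNReal.ofReal K * ‖a - b‖ₑ := fun a b => by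
    rw [Real.enorm_eq_ofReal_abs, Real.enorm_eq_ofReal_abs, ← ENNReal.ofReal_mul hK]
    exact ENNReal.ofReal_le_ofReal (hg a b)
  have hgE0 : ∀ a, ‖g a‖ₑ ≤ ENNReal.ofReal K * ‖a‖ₑ := fun a => by
    simpa [hg0] using hgE a 0
  have hN : wspNorm s p univ w ^ p < ⊤ := ENNReal.rpow_lt_top_of_nonneg hp0.le hw.2.ne
  have hKp : ENNReal.ofReal K ^ p ≠ ⊤ := ENNReal.rpow_ne_top_of_nonneg hp0.le ENNReal.ofReal_ne_top
  have hLp : ∀ A : Set (Rn n), ∫⁻ x in A, ‖g (w x)‖ₑ ^ p < ⊤ := fun A => by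
    calc ∫⁻ x in A, ‖g (w x)‖ₑ ^ p ≤ ∫⁻ x, ‖g (w x)‖ₑ ^ p := setLIntegral_le_lintegral _ _
      _ ≤ ∫⁻ x, ENNReal.ofReal K ^ p * ‖w x‖ₑ ^ p := lintegral_mono fun x => by
          simp only
          rw [← ENNReal.mul_rpow_of_nonneg _ _ hp0.le]
          exact ENNReal.rpow_le_rpow (hgE0 _) hp0.le
      _ = ENNReal.ofReal K ^ p * ∫⁻ x, ‖w x‖ₑ ^ p := lintegral_const_mul' _ _ hKp
      _ < ⊤ := by
          refine ENNReal.mul_lt_top hKp.lt_top (lt_of_le_of_lt ?_ hN)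
          simpa using lintegral_le_wspNorm_rpow (s := s) hp0 univ w
  refine ⟨⟨hm.restrict, ?_⟩, ⟨hm, ?_⟩, ?_⟩
  · rw [wspNorm]
    refine ENNReal.rpow_lt_top_of_nonneg (by positivity) (ENNReal.add_lt_top.2 ⟨?_, hLp _⟩).ne
    rw [wspSeminorm, ← ENNReal.rpow_mul, one_div_mul_cancel hp0.ne', ENNReal.rpow_one]
    calc _ ≤ ∫⁻ z : Rn n × Rn n, ‖g (w z.1) - g (w z.2)‖ₑ ^ p ∂(dmu n s p) :=
          setLIntegral_le_lintegral _ _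
      _ ≤ ∫⁻ z : Rn n × Rn n, ENNReal.ofReal K ^ p * ‖w z.1 - w z.2‖ₑ ^ p ∂(dmu n s p) :=
          lintegral_mono fun x => by
            simp only
            rw [← ENNReal.mul_rpow_of_nonneg _ _ hp0.le]
            exact ENNReal.rpow_le_rpow (hgE _ _) hp0.le
      _ = ENNReal.ofReal K ^ p * wspSeminorm s p univ w ^ p := by
          rw [lintegral_const_mul' _ _ hKp, wspSeminorm_rpow hp0]
      _ < ⊤ := ENNReal.mul_lt_top hKp.lt_top ((ENNReal.rpow_le_rpow
            (wspSeminorm_le_wspNorm hp0 _ _) hp0.le).trans_lt hN)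
  · rw [tailNorm]
    refine ENNReal.rpow_lt_top_of_nonneg (by simp; linarith) (ne_of_lt ?_)
    calc _ ≤ ∫⁻ x, Ω.indicator (fun x => 1 + ‖g (w x)‖ₑ ^ p) x := by
          refine lintegral_mono_ae ?_
          filter_upwards [hw0] with x hx
          by_cases hxΩ : x ∈ Ω
          · rw [indicator_of_mem hxΩ]
            refine (ENNReal.div_le_of_le_mul ?_ : _ ≤ 1 + ‖g (w x)‖ₑ ^ p)
            have h1 : (1 : ℝ≥0∞) ≤ ENNReal.ofReal (1 + ‖x‖ ^ ((n : ℝ) + s * p)) := by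
              rw [ENNReal.one_le_ofReal]
              have : 0 ≤ ‖x‖ ^ ((n : ℝ) + s * p) := by positivity
              linarith
            have h2 : ‖g (w x)‖ₑ ^ (p - 1) ≤ 1 + ‖g (w x)‖ₑ ^ p := by
              rcases le_total ‖g (w x)‖ₑ 1 with h | h
              · exact (ENNReal.rpow_le_one h (by linarith)).trans le_self_add
              · exact (ENNReal.rpow_le_rpow_of_exponent_le h (by linarith)).trans le_add_self
            calc _ ≤ (1 + ‖g (w x)‖ₑ ^ p) * 1 := by rwa [mul_one]
              _ ≤ _ := by gcongr
          · simp [hx hxΩ, hg0, hp]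
      _ < ⊤ := by
          rw [lintegral_indicator hΩ, lintegral_add_left measurable_const]
          refine ENNReal.add_lt_top.2 ⟨?_, hLp Ω⟩
          simpa using hΩb.measure_lt_top
  · filter_upwards [hw0] with x hx hxΩ
    simp [hx hxΩ, hg0]

/-! ### The energy inequality for the difference of two solutions -/

/-- The weak formulation with a time-independent test function. -/
theorem IsWeakSolution.eq_of_mem_X0 {Ω Ω' : Set (Rn n)} {I : Set ℝ} (hp : 0 < p)
    {f : ℝ → (Rn n → ℝ) → ℝ} {u : ℝ → Rn n → ℝ} (hu : IsWeakSolution s p Ω Ω' I f u)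
    {T₀ T₁ : ℝ} (hT : T₀ < T₁) (hI : Icc T₀ T₁ ⊆ I) {ψ : Rn n → ℝ} (hψ : ψ ∈ X0 s p Ω Ω')
    (hψ2 : MemLp ψ 2 (volume.restrict Ω)) :
    ∫ t in Icc T₀ T₁, ∫ z : Rn n × Rn n,
        Jp p (u t z.1 - u t z.2) * (ψ z.1 - ψ z.2) ∂(dmu n s p) =
      (∫ x in Ω, u T₀ x * ψ x) - (∫ x in Ω, u T₁ x * ψ x) + ∫ t in Icc T₀ T₁, f t ψ := by
  obtain ⟨-, -, -, h⟩ := hu T₀ T₁ hT hI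
  have := h (fun _ => ψ) (fun _ => hψ2.toLp ψ) ?_
  · rw [← this]
    have h0 : ∫ t in Icc T₀ T₁, ∫ x in Ω, u t x * (derivWithin (fun _ : ℝ => hψ2.toLp ψ)
        (Icc T₀ T₁) t : Lp ℝ 2 (volume.restrict Ω)) x = 0 := by
      refine integral_eq_zero_of_ae (Filter.Eventually.of_forall fun t => ?_)
      refine integral_eq_zero_of_ae ?_
      have hd : derivWithin (fun _ : ℝ => hψ2.toLp ψ) (Icc T₀ T₁) t = 0 := by simp
      rw [hd]
      filter_upwards [Lp.coeFn_zero ℝ 2 (volume.restrict Ω)] with x hx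
      simp only [hx, Pi.zero_apply, mul_zero]
    rw [h0, neg_zero, zero_add]
  · refine ⟨⟨?_, Filter.Eventually.of_forall fun _ => hψ, ?_⟩, fun t _ => hψ2.coeFn_toLp,
      contDiffOn_const⟩
    · exact AEStronglyMeasurable.comp_snd (f := ψ) hψ.2.1.1
    · rw [setLIntegral_const]
      refine ENNReal.mul_lt_top (ENNReal.rpow_lt_top_of_nonneg hp.le hψ.1.2.ne) ?_
      simp

theorem MemLinftyTime.exists_bound (hp : 0 < p) {J : Set ℝ} {u : ℝ → Rn n → ℝ}
    (hu : MemLinftyTime J volume (Wsp s p univ) (wspNorm s p univ) u) :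
    ∃ M : ℝ≥0∞, M ≠ ⊤ ∧ ∀ᵐ t ∂(volume.restrict J), wspSeminorm s p univ (u t) ≤ M := by
  refine ⟨_, hu.2.2.ne, ?_⟩
  filter_upwards [ENNReal.ae_le_essSup (μ := volume.restrict J)
    fun t => wspNorm s p univ (u t)] with t ht
  exact (wspSeminorm_le_wspNorm hp _ _).trans ht

/-- `∫_Ω Φ(W(t))` for a curve `W` in `L²(Ω)`. -/
noncomputable def curveEnergy (Ω : Set (Rn n)) (Φ : ℝ → ℝ) (W : ℝ → Lp ℝ 2 (volume.restrict Ω))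
    (t : ℝ) : ℝ := ∫ x in Ω, Φ (W t x)

section curve

variable {Ω : Set (Rn n)} {g : ℝ → ℝ} {K : ℝ}

theorem memLp_comp_Lp (hgc : Continuous g) (hgK : ∀ t, |g t| ≤ K * |t|)
    (W : Lp ℝ 2 (volume.restrict Ω)) : MemLp (fun x => g (W x)) 2 (volume.restrict Ω) :=
  (Lp.memLp W).of_le_mul (c := K) (hgc.comp_aestronglyMeasurable (Lp.memLp W).1)
    (Filter.Eventually.of_forall fun _ => hgK _)

theorem integrable_prim_comp_Lp (hgc : Continuous g) (hg : Monotone g) (hg0 : g 0 = 0)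
    (hgK : ∀ t, |g t| ≤ K * |t|) (W : Lp ℝ 2 (volume.restrict Ω)) :
    Integrable (fun x => prim g (W x)) (volume.restrict Ω) := by
  have h1 : Integrable (fun x => g (W x) * W x) (volume.restrict Ω) :=
    (memLp_comp_Lp hgc hgK W).integrable_mul (Lp.memLp W)
  refine h1.mono' ((continuous_prim hgc).comp_aestronglyMeasurable (Lp.memLp W).1)
    (Filter.Eventually.of_forall fun x => ?_)
  rw [Real.norm_eq_abs, abs_of_nonneg (prim_nonneg_of_monotone hgc hg hg0 _)]
  have := prim_sub_le_of_monotone hgc hg 0 (W x)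
  simpa [prim_zero] using this

/-- Convexity of the energy. -/
theorem curveEnergy_sub_le (hgc : Continuous g) (hg : Monotone g) (hg0 : g 0 = 0)
    (hgK : ∀ t, |g t| ≤ K * |t|) (W : ℝ → Lp ℝ 2 (volume.restrict Ω)) (a b : ℝ) :
    curveEnergy Ω (prim g) W b - curveEnergy Ω (prim g) W a ≤
      ∫ x in Ω, g (W b x) * (W b x - W a x) := by
  rw [curveEnergy, curveEnergy, ← integral_sub (integrable_prim_comp_Lp hgc hg hg0 hgK _)
    (integrable_prim_comp_Lp hgc hg hg0 hgK _)]
  refine integral_mono ((integrable_prim_comp_Lp hgc hg hg0 hgK _).sub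
    (integrable_prim_comp_Lp hgc hg hg0 hgK _)) ?_ fun x => prim_sub_le_of_monotone hgc hg _ _
  exact (memLp_comp_Lp hgc hgK (W b)).integrable_mul ((Lp.memLp (W b)).sub (Lp.memLp (W a)))

/-- The convexity inequality, used in both directions, shows that the energy is continuous. -/
theorem continuous_curveEnergy (hgc : Continuous g) (hg : Monotone g) (hg0 : g 0 = 0)
    (hK : 0 ≤ K) (hgK : ∀ t, |g t| ≤ K * |t|) {W : ℝ → Lp ℝ 2 (volume.restrict Ω)}
    (hW : Continuous W) : Continuous (curveEnergy Ω (prim g) W) := by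
  have hle : ∀ a b, curveEnergy Ω (prim g) W b - curveEnergy Ω (prim g) W a ≤
      K * ‖W b‖ * ‖W b - W a‖ := by
    intro a b
    have hgL := memLp_comp_Lp hgc hgK (W b)
    have h1 : ∫ x in Ω, g (W b x) * (W b x - W a x) = inner ℝ (hgL.toLp _) (W b - W a) := by
      rw [L2.inner_def]
      refine integral_congr_ae ?_
      filter_upwards [hgL.coeFn_toLp, Lp.coeFn_sub (W b) (W a)] with x h1 h2
      rw [h1, h2, Pi.sub_apply, RCLike.inner_apply, conj_trivial, mul_comm]
    have h2 : ‖hgL.toLp _‖ ≤ K * ‖W b‖ := by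
      refine Lp.norm_le_mul_norm_of_ae_le_mul ?_
      filter_upwards [hgL.coeFn_toLp] with x hx
      rw [hx]; exact hgK _
    refine (curveEnergy_sub_le hgc hg hg0 hgK W a b).trans ?_
    rw [h1]
    refine (real_inner_le_norm _ _).trans ?_
    gcongr
  rw [continuous_iff_continuousAt]
  intro a
  rw [ContinuousAt, tendsto_iff_dist_tendsto_zero]
  have hlim : Filter.Tendsto (fun b => K * ‖W b‖ * ‖W b - W a‖ + K * ‖W a‖ * ‖W a - W b‖)
      (nhds a) (nhds 0) := by
    have : Continuous fun b => K * ‖W b‖ * ‖W b - W a‖ + K * ‖W a‖ * ‖W a - W b‖ := by fun_prop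
    simpa using this.tendsto a
  refine squeeze_zero (fun _ => dist_nonneg) (fun b => ?_) hlim
  rw [Real.dist_eq, abs_le]
  have := hle a b
  have := hle b a
  have h3 : 0 ≤ K * ‖W b‖ * ‖W b - W a‖ := by positivity
  have h4 : 0 ≤ K * ‖W a‖ * ‖W a - W b‖ := by positivity
  constructor <;> linarith

end curve

/-- On a compact time interval the difference of two solutions is represented by a continuous
curve in `L²(Ω)`, here extended to all times by constants. -/
theorem exists_curve {Ω Ω' : Set (Rn n)} {f : ℝ → (Rn n → ℝ) → ℝ} {u v : ℝ → Rn n → ℝ}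
    {I : Set ℝ} (hu : IsWeakSolution s p Ω Ω' I f u) (hv : IsWeakSolution s p Ω Ω' I f v)
    {α β : ℝ} (hαβ : α < β) (hI : Icc α β ⊆ I) :
    (∀ t ∈ Icc α β, MemLp (u t) 2 (volume.restrict Ω)) ∧
    (∀ t ∈ Icc α β, MemLp (v t) 2 (volume.restrict Ω)) ∧
    ∃ W : ℝ → Lp ℝ 2 (volume.restrict Ω), Continuous W ∧
      ∀ t ∈ Icc α β, (W t : Rn n → ℝ) =ᵐ[volume.restrict Ω] fun x => u t x - v t x := by
  obtain ⟨-, -, ⟨U, hU, hUc⟩, -⟩ := hu α β hαβ hI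
  obtain ⟨-, -, ⟨V, hV, hVc⟩, -⟩ := hv α β hαβ hI
  refine ⟨fun t ht => (memLp_congr_ae (hU t ht)).1 (Lp.memLp _),
    fun t ht => (memLp_congr_ae (hV t ht)).1 (Lp.memLp _),
    IccExtend hαβ.le (fun t => U t - V t), ?_, fun t ht => ?_⟩
  · exact ((hUc.sub hVc).domRestrict).Icc_extend'
  · rw [IccExtend_of_mem _ _ ht]
    filter_upwards [hU t ht, hV t ht, Lp.coeFn_sub (U t) (V t)] with x h1 h2 h3
    rw [h3, Pi.sub_apply, h1, h2]

/-- The energy inequality: `∂ₜw` may be tested with the Lipschitz function `g(w)` of `w = u - v`,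
although `w` is not differentiable in time. Convexity of the energy allows one to use only
time-independent test functions `g(w(t))`, at the price of freezing the time in the test function;
the averaging argument undoes this. -/
theorem energy_inequality (hp : 1 < p) {Ω Ω' : Set (Rn n)} (hΩ : MeasurableSet Ω)
    (hΩb : Bornology.IsBounded Ω) {f : ℝ → (Rn n → ℝ) → ℝ} {u v : ℝ → Rn n → ℝ}
    {α β : ℝ} (hαβ : α < β) {I : Set ℝ} (hI : Icc α β ⊆ I)
    (hu : IsWeakSolution s p Ω Ω' I f u) (hv : IsWeakSolution s p Ω Ω' I f v)
    (huL : MemLinftyTime (Icc α β) volume (Wsp s p univ) (wspNorm s p univ) u)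
    (hvL : MemLinftyTime (Icc α β) volume (Wsp s p univ) (wspNorm s p univ) v)
    (hw : ∀ᵐ t ∂(volume.restrict (Icc α β)), (fun x => u t x - v t x) ∈ Wsp0 s p Ω)
    {g : ℝ → ℝ} {K : ℝ} (hK : 0 ≤ K) (hgc : Continuous g) (hgm : Monotone g) (hg0 : g 0 = 0)
    (hgK : ∀ a b, |g a - g b| ≤ K * |a - b|) {W : ℝ → Lp ℝ 2 (volume.restrict Ω)}
    (hWc : Continuous W)
    (hW : ∀ t ∈ Icc α β, (W t : Rn n → ℝ) =ᵐ[volume.restrict Ω] fun x => u t x - v t x)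
    {a b : ℝ} (ha : α < a) (hab : a ≤ b) (hb : b ≤ β) :
    (∀ᵐ t ∂(volume.restrict (Icc a b)),
      Integrable (diffForm p (u t) (v t) (fun x => g (u t x - v t x))) (dmu n s p)) ∧
    IntegrableOn (fun t => ∫ z, diffForm p (u t) (v t) (fun x => g (u t x - v t x)) z ∂(dmu n s p))
      (Icc a b) ∧
    curveEnergy Ω (prim g) W b - curveEnergy Ω (prim g) W a ≤
      -∫ t in Icc a b, ∫ z, diffForm p (u t) (v t) (fun x => g (u t x - v t x)) z ∂(dmu n s p) := by
  have hp0 : 0 < p := by linarith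
  have hconj := holderConjugate_ofReal hp
  set J := Icc α β with hJ
  have hJm : MeasurableSet J := measurableSet_Icc
  have hJf : volume J ≠ ⊤ := by simp [hJ]
  have hgK0 : ∀ t, |g t| ≤ K * |t| := fun t => by simpa [hg0] using hgK t 0
  obtain ⟨M, hM, hMu⟩ := huL.exists_bound hp0
  obtain ⟨M', hM', hMv⟩ := hvL.exists_bound hp0
  have hXu := memLp_diffQuotTime hp0 hJm hJf huL.1 hM hMu
  have hXv := memLp_diffQuotTime hp0 hJm hJf hvL.1 hM' hMv
  set Au : ℝ × (Rn n × Rn n) → ℝ := fun w => Jp p (diffQuotTime s p J u w) with hAu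
  set Av : ℝ × (Rn n × Rn n) → ℝ := fun w => Jp p (diffQuotTime s p J v w) with hAv
  have hAuL : MemLp Au (ENNReal.ofReal (p / (p - 1))) volume := memLp_Jp hp hXu
  have hAvL : MemLp Av (ENNReal.ofReal (p / (p - 1))) volume := memLp_Jp hp hXv
  set A : ℝ × (Rn n × Rn n) → ℝ := fun w => Au w - Av w with hA
  have hAL : MemLp A (ENNReal.ofReal (p / (p - 1))) volume := hAuL.sub hAvL
  set D : ℝ × (Rn n × Rn n) → ℝ := diffQuotTime s p J (fun t x => g (u t x - v t x)) with hD
  have hDL : MemLp D (ENNReal.ofReal p) volume := by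
    refine (hXu.sub hXv).of_le_mul (c := K) ?_ (Filter.Eventually.of_forall fun w => ?_)
    · exact aestronglyMeasurable_diffQuotTime hJm
        (hgc.comp_aestronglyMeasurable (huL.1.sub hvL.1))
    · rw [hD, Pi.sub_apply]
      by_cases hw : w.1 ∈ J
      · obtain ⟨t, z⟩ := w
        rw [diffQuotTime_of_mem hw, diffQuotTime_of_mem hw, diffQuotTime_of_mem hw, diffQuot,
          diffQuot, diffQuot, ← sub_mul, norm_mul, norm_mul, ← mul_assoc]
        gcongr
        refine (hgK _ _).trans_eq ?_
        rw [Real.norm_eq_abs]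
        congr 2; ring
      · simp [diffQuotTime, hw]
  have hq1 : 1 ≤ ENNReal.ofReal (p / (p - 1)) := by
    rw [ENNReal.one_le_ofReal, one_le_div (by linarith)]; linarith
  have hsub : Icc a b ⊆ J := Icc_subset_Icc ha.le hb
  have hprod : ∀ t ∈ J, ∀ z, A (t, z) * D (t, z) = ‖z.1 - z.2‖ ^ (-((n : ℝ) + s * p)) *
      diffForm p (u t) (v t) (fun x => g (u t x - v t x)) z := fun t ht z => by
    rw [diffForm_eq_diffQuot hp]
    simp only [hA, hAu, hAv, hD, diffQuotTime_of_mem ht]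
  have hform : ∀ t ∈ J, ∫ z, A (t, z) * D (t, z) =
      ∫ z, diffForm p (u t) (v t) (fun x => g (u t x - v t x)) z ∂(dmu n s p) := fun t ht => by
    rw [integral_dmu]
    simp only [hprod t ht]
  have hADi : Integrable (fun w => A w * D w) ((volume : Measure ℝ).prod volume) :=
    hAL.integrable_mul hDL
  refine ⟨?_, ?_, ?_⟩
  · filter_upwards [ae_restrict_of_ae hADi.prod_right_ae, ae_restrict_mem measurableSet_Icc]
      with t ht htm
    rw [integrable_dmu_iff]
    simpa only [hprod t (hsub htm)] using ht
  · refine (hADi.integral_prod_left.integrableOn (s := Icc a b)).congr_fun (fun t ht => ?_)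
      measurableSet_Icc
    exact hform t (hsub ht)
  rw [← setIntegral_congr_fun measurableSet_Icc fun t ht => hform t (hsub ht)]
  refine energy_le_of_backward_difference hq1 ENNReal.ofReal_ne_top hAL hDL
    (continuous_curveEnergy hgc hgm hg0 hK hgK0 hWc) hab (sub_pos.2 ha) ?_
  have hDt : ∀ᵐ t, MemLp (fun z => D (t, z)) (ENNReal.ofReal p) volume := by
    have h2 := ((memLp_ofReal_iff hp0).1 hDL)
    have h3 : ∫⁻ t, ∫⁻ z, ‖D (t, z)‖ₑ ^ p < ⊤ := by
      rw [← lintegral_prod _ (h2.1.enorm.pow_const p)]; exact h2.2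
    have h4 := ae_lt_top' (h2.1.enorm.pow_const p).lintegral_prod_right' h3.ne
    have h5 : ∀ᵐ t, AEStronglyMeasurable (fun z => D (t, z)) volume := h2.1.prodMk_left
    filter_upwards [h4, h5] with t ht h5t
    exact (memLp_ofReal_iff hp0).2 ⟨h5t, ht⟩
  have hwJ := (ae_restrict_iff' hJm).1 hw
  filter_upwards [hDt, hwJ] with t hDt hwt htm h h0 hh
  have htJ : t ∈ J := hsub htm
  have hthJ : t - h ∈ J := ⟨by linarith [htm.1], by linarith [htJ.2]⟩
  have hIJ : Icc (t - h) t ⊆ J := Icc_subset_Icc hthJ.1 htJ.2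
  have hlt : t - h < t := by linarith
  set ψ : Rn n → ℝ := fun x => g (u t x - v t x) with hψ
  have hw0 := ae_eq_zero_of_mem_Wsp0 hp0 hΩ (hwt htJ)
  have hψX : ψ ∈ X0 s p Ω Ω' := comp_mem_X0 hp hΩ hΩb (hwt htJ).1 hw0 hK hg0 hgK hgc
  have hgW : (fun x => g (W t x)) =ᵐ[volume.restrict Ω] ψ := by
    filter_upwards [hW t htJ] with x hx
    rw [hx]
  have hψ2 : MemLp ψ 2 (volume.restrict Ω) :=
    (memLp_congr_ae hgW).1 (memLp_comp_Lp hgc hgK0 (W t))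
  have hwu := hu.eq_of_mem_X0 hp0 hlt (hIJ.trans hI) hψX hψ2
  have hwv := hv.eq_of_mem_X0 hp0 hlt (hIJ.trans hI) hψX hψ2
  obtain ⟨hu2, hv2, -⟩ := exists_curve hu hv hαβ hI
  refine (curveEnergy_sub_le hgc hgm hg0 hgK0 W (t - h) t).trans (le_of_eq ?_)
  have e1 : ∫ x in Ω, g (W t x) * (W t x - W (t - h) x) =
      ((∫ x in Ω, u t x * ψ x) - ∫ x in Ω, v t x * ψ x) -
        ((∫ x in Ω, u (t - h) x * ψ x) - ∫ x in Ω, v (t - h) x * ψ x) := by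
    have i1 : Integrable (fun x => u t x * ψ x) (volume.restrict Ω) :=
      (hu2 t htJ).integrable_mul hψ2
    have i2 : Integrable (fun x => v t x * ψ x) (volume.restrict Ω) :=
      (hv2 t htJ).integrable_mul hψ2
    have i3 : Integrable (fun x => u (t - h) x * ψ x) (volume.restrict Ω) :=
      (hu2 _ hthJ).integrable_mul hψ2
    have i4 : Integrable (fun x => v (t - h) x * ψ x) (volume.restrict Ω) :=
      (hv2 _ hthJ).integrable_mul hψ2
    rw [← integral_sub i1 i2, ← integral_sub i3 i4]
    refine Eq.trans ?_ (integral_sub (i1.sub i2) (i3.sub i4))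
    refine integral_congr_ae ?_
    filter_upwards [hW t htJ, hW _ hthJ] with x h1 h2
    simp only [h1, h2, hψ]
    ring
  -- both factors are integrable over `[t-h,t] × ℝ²ⁿ`, with the test function frozen at time `t`
  have hmeas : (volume.restrict (Icc (t - h) t)).prod (volume : Measure (Rn n × Rn n)) =
      ((volume : Measure ℝ).prod volume).restrict (Icc (t - h) t ×ˢ univ) := by
    rw [← Measure.prod_restrict, Measure.restrict_univ]
  have hDf : MemLp (fun w : ℝ × (Rn n × Rn n) => D (t, w.2)) (ENNReal.ofReal p)
      ((volume.restrict (Icc (t - h) t)).prod volume) := hDt.comp_snd _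
  have j1 : Integrable (fun w : ℝ × (Rn n × Rn n) => Au w * D (t, w.2))
      ((volume.restrict (Icc (t - h) t)).prod volume) := by
    refine MemLp.integrable_mul (?_ : MemLp Au (ENNReal.ofReal (p / (p - 1))) _) hDf
    rw [hmeas]; exact hAuL.restrict _
  have j2 : Integrable (fun w : ℝ × (Rn n × Rn n) => Av w * D (t, w.2))
      ((volume.restrict (Icc (t - h) t)).prod volume) := by
    refine MemLp.integrable_mul (?_ : MemLp Av (ENNReal.ofReal (p / (p - 1))) _) hDf
    rw [hmeas]; exact hAvL.restrict _
  have e2 : ∫ τ in (t - h)..t, ∫ y, A (τ, y) * D (t, y) =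
      (∫ τ in Icc (t - h) t, ∫ z : Rn n × Rn n,
        Jp p (u τ z.1 - u τ z.2) * (ψ z.1 - ψ z.2) ∂(dmu n s p)) -
      ∫ τ in Icc (t - h) t, ∫ z : Rn n × Rn n,
        Jp p (v τ z.1 - v τ z.2) * (ψ z.1 - ψ z.2) ∂(dmu n s p) := by
    have k1 : ∫ τ in Icc (t - h) t, ∫ z : Rn n × Rn n,
        Jp p (u τ z.1 - u τ z.2) * (ψ z.1 - ψ z.2) ∂(dmu n s p) =
        ∫ τ in Icc (t - h) t, ∫ z, Au (τ, z) * D (t, z) := by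
      refine setIntegral_congr_fun measurableSet_Icc fun τ hτ => ?_
      simp only [hAu, hD, diffQuotTime_of_mem htJ, diffQuotTime_of_mem (hIJ hτ)]
      exact (integral_Jp_diffQuot_mul hp _ _).symm
    have k2 : ∫ τ in Icc (t - h) t, ∫ z : Rn n × Rn n,
        Jp p (v τ z.1 - v τ z.2) * (ψ z.1 - ψ z.2) ∂(dmu n s p) =
        ∫ τ in Icc (t - h) t, ∫ z, Av (τ, z) * D (t, z) := by
      refine setIntegral_congr_fun measurableSet_Icc fun τ hτ => ?_
      simp only [hAv, hD, diffQuotTime_of_mem htJ, diffQuotTime_of_mem (hIJ hτ)]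
      exact (integral_Jp_diffQuot_mul hp _ _).symm
    rw [k1, k2, ← integral_sub j1.integral_prod_left j2.integral_prod_left,
      intervalIntegral.integral_of_le hlt.le, ← integral_Icc_eq_integral_Ioc]
    refine integral_congr_ae ?_
    filter_upwards [j1.prod_right_ae, j2.prod_right_ae] with τ h1 h2
    rw [← integral_sub h1 h2]
    simp only [hA, sub_mul]
  rw [e1, e2, hwu, hwv]
  ring

/-! ### Exponential decay -/

section limit

variable {Ω : Set (Rn n)} {m k : ℝ}

theorem abs_truncPow_le (hm : 2 ≤ m) (hk : 0 ≤ k) (t : ℝ) :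
    |truncPow m k t| ≤ (√(m - 1) * k ^ ((m - 2) / 2)) ^ 2 * |t| := by
  simpa [truncPow_zero] using truncPow_sub_le hm hk t 0

theorem ofReal_mul_curveEnergy (hm : 2 ≤ m) (hk : 0 ≤ k)
    (W : ℝ → Lp ℝ 2 (volume.restrict Ω)) (t : ℝ) :
    ENNReal.ofReal (m * curveEnergy Ω (truncEnergy m k) W t) =
      ∫⁻ x in Ω, ENNReal.ofReal (m * truncEnergy m k (W t x)) := by
  rw [curveEnergy, ← integral_const_mul]
  refine ofReal_integral_eq_lintegral_ofReal ?_ (Filter.Eventually.of_forall fun x =>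
    mul_nonneg (by linarith) (truncEnergy_nonneg hm _))
  exact (integrable_prim_comp_Lp (continuous_truncPow hm) (monotone_truncPow hm) truncPow_zero
    (abs_truncPow_le hm hk) (W t)).const_mul m

theorem ofReal_mul_curveEnergy_le (hm : 2 ≤ m) (hk : 0 ≤ k)
    (W : ℝ → Lp ℝ 2 (volume.restrict Ω)) (t : ℝ) :
    ENNReal.ofReal (m * curveEnergy Ω (truncEnergy m k) W t) ≤ Im Ω m (W t) := by
  have hm0 : 0 < m := by linarith
  rw [ofReal_mul_curveEnergy hm hk, Im]
  refine lintegral_mono fun x => ?_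
  simp only
  rw [Real.enorm_eq_ofReal_abs, ENNReal.ofReal_rpow_of_nonneg (abs_nonneg _) hm0.le]
  refine ENNReal.ofReal_le_ofReal ?_
  rw [← le_div_iff₀' hm0]
  exact (truncEnergy_le hm hk _).1

/-- A bound for all truncated energies is a bound for `I_m`, by Fatou's lemma. -/
theorem Im_le_of_forall_trunc (hm : 2 ≤ m) (W : ℝ → Lp ℝ 2 (volume.restrict Ω)) (t : ℝ)
    {B : ℝ≥0∞}
    (hB : ∀ k : ℕ, ENNReal.ofReal (m * curveEnergy Ω (truncEnergy m k) W t) ≤ B) :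
    Im Ω m (W t) ≤ B := by
  have hm0 : 0 < m := by linarith
  have hlim : ∀ x, Filter.liminf (fun k : ℕ => ENNReal.ofReal (m * truncEnergy m k (W t x)))
      Filter.atTop = ‖W t x‖ₑ ^ m := by
    intro x
    refine Filter.Tendsto.liminf_eq (tendsto_const_nhds.congr' ?_)
    filter_upwards [Filter.eventually_ge_atTop ⌈|W t x|⌉₊] with k hk
    rw [(truncEnergy_le hm k.cast_nonneg (W t x)).2 ((Nat.le_ceil _).trans (by exact_mod_cast hk)),
      mul_div_cancel₀ _ hm0.ne', Real.enorm_eq_ofReal_abs,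
      ENNReal.ofReal_rpow_of_nonneg (abs_nonneg _) hm0.le]
  rw [Im]
  simp only [← hlim]
  refine (lintegral_liminf_le' fun k => ?_).trans ?_
  · exact (((continuous_truncEnergy hm).comp_aestronglyMeasurable
      (Lp.memLp (W t)).1).aemeasurable.const_mul m).ennreal_ofReal
  · refine Filter.liminf_le_of_le (by isBoundedDefault) fun b hb => ?_
    obtain ⟨k, hk⟩ := hb.exists
    rw [← ofReal_mul_curveEnergy hm k.cast_nonneg] at hk
    exact hk.trans (hB k)

end limit

theorem integral_diffForm_prim_nonneg (hp : 1 < p) (hp2 : p < 2) {h : ℝ → ℝ} (hc : Continuous h)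
    (u v : Rn n → ℝ) :
    0 ≤ ∫ z, diffForm p u v (fun x => prim (fun t => h t ^ 2) (u x - v x)) z ∂(dmu n s p) :=
  integral_nonneg fun z => by
    have h1 : 0 ≤ p - 1 := by linarith
    exact le_trans (by positivity) (weight_mul_sq_le_diffForm_prim hp hp2 hc u v z)

/-- The decay of the truncated energies. Either the essential supremum `S` of the seminorms is zero
and the energy vanishes, or it is a positive number and Grönwall's inequality applies. -/
theorem curveEnergy_decay (hp : 1 < p) (hp2 : p < 2) {Ω Ω' : Set (Rn n)} (hΩ : MeasurableSet Ω)
    (hΩb : Bornology.IsBounded Ω) {C : ℝ} (hC : 0 < C)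
    (hSob : ∀ f : Rn n → ℝ, AEStronglyMeasurable f volume →
      (∀ᵐ x, x ∉ Ω → f x = 0) → ∫⁻ x in Ω, ‖f x‖ₑ ^ (2 : ℝ) ≠ ⊤ →
      ∫⁻ x in Ω, ‖f x‖ₑ ^ (2 : ℝ) ≤ ENNReal.ofReal C * wspSeminorm s p univ f ^ (2 : ℝ))
    {f : ℝ → (Rn n → ℝ) → ℝ} {u v : ℝ → Rn n → ℝ} {α β : ℝ} (hαβ : α < β) {I : Set ℝ}
    (hI : Icc α β ⊆ I) (hu : IsWeakSolution s p Ω Ω' I f u) (hv : IsWeakSolution s p Ω Ω' I f v)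
    (huL : MemLinftyTime (Icc α β) volume (Wsp s p univ) (wspNorm s p univ) u)
    (hvL : MemLinftyTime (Icc α β) volume (Wsp s p univ) (wspNorm s p univ) v)
    (hw : ∀ᵐ t ∂(volume.restrict (Icc α β)), (fun x => u t x - v t x) ∈ Wsp0 s p Ω)
    {W : ℝ → Lp ℝ 2 (volume.restrict Ω)} (hWc : Continuous W)
    (hW : ∀ t ∈ Icc α β, (W t : Rn n → ℝ) =ᵐ[volume.restrict Ω] fun x => u t x - v t x)
    {t₁ : ℝ} (ht₁ : α < t₁) (ht : t₁ < β) {m k : ℝ} (hm : 2 ≤ m) (hk : 0 ≤ k)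
    {S : ℝ} (hS : 0 ≤ S)
    (hSsup : ∀ᵐ τ ∂(volume.restrict (Icc t₁ β)),
      wspSeminorm s p univ (v τ) + wspSeminorm s p univ (u τ) ≤ ENNReal.ofReal S) :
    (S = 0 → curveEnergy Ω (truncEnergy m k) W β = 0) ∧
    (0 < S → curveEnergy Ω (truncEnergy m k) W β ≤ curveEnergy Ω (truncEnergy m k) W t₁ *
      Real.exp (-(2 * (p - 1) / C * S ^ (p - 2) * (β - t₁)))) := by
  have hp0 : 0 < p := by linarith
  have hp1 : 0 < p - 1 := by linarith
  have hp2' : 0 < 2 - p := by linarith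
  set E := curveEnergy Ω (truncEnergy m k) W with hE
  set B : ℝ → ℝ := fun t =>
    ∫ z, diffForm p (u t) (v t) (fun x => truncPow m k (u t x - v t x)) z ∂(dmu n s p) with hB
  have hEc : Continuous E := continuous_curveEnergy (continuous_truncPow hm)
    (monotone_truncPow hm) truncPow_zero (sq_nonneg _) (abs_truncPow_le hm hk) hWc
  have hE0 : ∀ t, 0 ≤ E t := fun t => integral_nonneg fun x => truncEnergy_nonneg hm _
  have hineq : ∀ {a b : ℝ}, t₁ ≤ a → a ≤ b → b ≤ β → _ := fun {a b} ha hab hb =>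
    energy_inequality hp hΩ hΩb hαβ hI hu hv huL hvL hw (sq_nonneg _) (continuous_truncPow hm)
      (monotone_truncPow hm) truncPow_zero (truncPow_sub_le hm hk) hWc hW (ht₁.trans_le ha) hab hb
  obtain ⟨hu2, hv2, -⟩ := exists_curve hu hv hαβ hI
  have hsub : Icc t₁ β ⊆ Icc α β := Icc_subset_Icc_left ht₁.le
  have hcoer : ∀ᵐ t ∂(volume.restrict (Icc t₁ β)),
      2 * E t ≤ C / (p - 1) * B t * S ^ (2 - p) := by
    filter_upwards [(hineq le_rfl ht.le le_rfl).1, hSsup, ae_restrict_mem measurableSet_Icc,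
      ae_restrict_of_ae_restrict_of_subset hsub huL.2.1,
      ae_restrict_of_ae_restrict_of_subset hsub hvL.2.1,
      ae_restrict_of_ae_restrict_of_subset hsub hw] with t hint hSt htm hut hvt hwt
    have hum : AEStronglyMeasurable (u t) volume := by simpa using hut.1
    have hvm : AEStronglyMeasurable (v t) volume := by simpa using hvt.1
    have h1 := energy_le_integral_diffForm hp hp2 hC hSob (continuous_truncRoot (k := k) hm)
      (truncRoot_nonneg hk) truncRoot_neg (monotoneOn_truncRoot hm hk) (truncRoot_le hm hk)
      hum hvm (ae_eq_zero_of_mem_Wsp0 hp0 hΩ hwt) ((hu2 t (hsub htm)).sub (hv2 t (hsub htm))) hint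
    have hEt : E t = ∫ x in Ω, truncEnergy m k (u t x - v t x) := by
      refine integral_congr_ae ?_
      filter_upwards [hW t (hsub htm)] with x hx
      rw [hx]
    have hB0 : 0 ≤ B t := integral_diffForm_prim_nonneg hp hp2 (continuous_truncRoot hm) _ _
    have h2 : ENNReal.ofReal (2 * E t) ≤ ENNReal.ofReal (C / (p - 1) * B t * S ^ (2 - p)) := by
      rw [ENNReal.ofReal_mul (q := S ^ (2 - p)) (by positivity),
        ← ENNReal.ofReal_rpow_of_nonneg hS hp2'.le, hEt]
      exact h1.trans (by gcongr; exact le_rfl)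
    exact (ENNReal.ofReal_le_ofReal_iff (by positivity)).1 h2
  constructor
  · intro hS0
    have h0 : E =ᵐ[volume.restrict (Icc t₁ β)] fun _ => 0 := by
      filter_upwards [hcoer] with t ht
      rw [hS0, Real.zero_rpow hp2'.ne', mul_zero] at ht
      exact le_antisymm (by linarith) (hE0 t)
    exact Measure.eqOn_Icc_of_ae_eq volume ht.ne h0 hEc.continuousOn continuousOn_const
      (right_mem_Icc.2 ht.le)
  · intro hSpos
    refine le_mul_exp_of_sub_le hEc hE0 (by positivity) ht.le fun a b ha hab hb => ?_
    obtain ⟨-, hi, hle⟩ := hineq ha hab hb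
    refine hle.trans (neg_le_neg ?_)
    rw [← integral_const_mul]
    refine setIntegral_mono_ae_restrict (hEc.integrableOn_Icc.const_mul _) hi ?_
    filter_upwards [ae_restrict_of_ae_restrict_of_subset (Icc_subset_Icc ha hb) hcoer] with t ht
    have h3 : S ^ (2 - p) * S ^ (p - 2) = 1 := by
      rw [← Real.rpow_add hSpos]; simp
    calc 2 * (p - 1) / C * S ^ (p - 2) * E t = (p - 1) / C * S ^ (p - 2) * (2 * E t) := by ring
      _ ≤ (p - 1) / C * S ^ (p - 2) * (C / (p - 1) * B t * S ^ (2 - p)) := by gcongr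
      _ = ((p - 1) / C * (C / (p - 1))) * (S ^ (2 - p) * S ^ (p - 2)) * B t := by ring
      _ = B t := by rw [h3]; field_simp

end FracPLap

open FracPLap
theorem mainTheorem4 (n : ℕ) (hn : 2 ≤ n) (s p : ℝ) (hs0 : 0 < s) (hs1 : s < 1)
    (hp : 2 * (n : ℝ) / ((n : ℝ) + 2 * s) ≤ p) (hp2 : p < 2)
    (Ω : Set (Rn n)) (hΩo : IsOpen Ω) (hΩc : IsConnected Ω) (hΩb : Bornology.IsBounded Ω) :
    ∃ C : ℝ, 0 < C ∧
      ∀ Ω' : Set (Rn n), IsOpen Ω' → Bornology.IsBounded Ω' → closure Ω ⊆ Ω' →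
      ∀ f : ℝ → (Rn n → ℝ) → ℝ,
      (∀ a b : ℝ, 0 < a → a < b → MemLpTimeDual (p / (p - 1)) s p Ω Ω' (Icc a b) f) →
      ∀ u v : ℝ → Rn n → ℝ,
      IsWeakSolution s p Ω Ω' (Ioi 0) f u →
      IsWeakSolution s p Ω Ω' (Ioi 0) f v →
      (∀ a b : ℝ, 0 < a → a < b →
        MemLinftyTime (Icc a b) volume (Wsp s p univ) (wspNorm s p univ) u) →
      (∀ a b : ℝ, 0 < a → a < b →
        MemLinftyTime (Icc a b) volume (Wsp s p univ) (wspNorm s p univ) v) →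
      (∀ a b : ℝ, 0 < a → a < b →
        MemLpTime p (Icc a b) volume (Wsp0 s p Ω) (wspNorm s p univ)
          (fun t x => u t x - v t x)) →
      ∀ m : ℝ, 2 ≤ m → ∀ t₁ t₂ : ℝ, 0 < t₁ → t₁ ≤ t₂ →
        Im Ω m (fun x => u t₂ x - v t₂ x) ≤
          Im Ω m (fun x => u t₁ x - v t₁ x) *
            EReal.exp (-((ENNReal.ofReal (C * ((m - 1) / m) * (t₂ - t₁)) *
              decayL s p u v t₁ t₂ : ℝ≥0∞) : EReal)) := by
  have hn' : (2 : ℝ) ≤ n := by exact_mod_cast hn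
  have hp1 : 1 < p := by
    refine lt_of_lt_of_le ?_ hp
    rw [lt_div_iff₀ (by positivity)]
    linarith
  have hp0 : 0 < p := by linarith
  have hp1' : 0 < p - 1 := by linarith
  obtain ⟨C, hC, hSob⟩ := exists_sobolev (by omega : 0 < n) hs0 hp1 hp hΩo.measurableSet hΩb
  refine ⟨2 * (p - 1) / C, by positivity, ?_⟩
  intro Ω' _ _ _ f _ u v hu hv huL hvL hw m hm t₁ t₂ ht₁ ht
  have hm0 : 0 < m := by linarith
  rcases ht.eq_or_lt with rfl | ht
  · simp
  -- the averaging in time needs some room to the left of `t₁`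
  have hα : 0 < t₁ / 2 := by linarith
  have hα1 : t₁ / 2 < t₁ := by linarith
  have hαβ : t₁ / 2 < t₂ := by linarith
  have hI : Icc (t₁ / 2) t₂ ⊆ Ioi 0 := fun x hx => hα.trans_le hx.1
  obtain ⟨-, -, W, hWc, hW⟩ := exists_curve hu hv hαβ hI
  have hIm : ∀ t ∈ Icc (t₁ / 2) t₂, Im Ω m (fun x => u t x - v t x) = Im Ω m (W t) := by
    intro t ht
    refine lintegral_congr_ae ?_
    filter_upwards [hW t ht] with x hx
    rw [hx]
  rw [hIm t₂ (right_mem_Icc.2 hαβ.le), hIm t₁ ⟨hα1.le, ht.le⟩]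
  set S := essSup (fun τ => wspSeminorm s p univ (v τ) + wspSeminorm s p univ (u τ))
    (volume.restrict (Icc t₁ t₂)) with hS
  have hSt : S ≠ ⊤ := by
    obtain ⟨M, hM, hMu⟩ := (huL t₁ t₂ ht₁ ht).exists_bound hp0
    obtain ⟨M', hM', hMv⟩ := (hvL t₁ t₂ ht₁ ht).exists_bound hp0
    refine ne_top_of_le_ne_top (ENNReal.add_ne_top.2 ⟨hM', hM⟩) (essSup_le_of_ae_le _ ?_)
    filter_upwards [hMu, hMv] with t h1 h2
    exact add_le_add h2 h1
  have hdecay := fun k : ℕ => curveEnergy_decay hp1 hp2 hΩo.measurableSet hΩb hC hSob hαβ hI hu hv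
    (huL _ _ hα hαβ) (hvL _ _ hα hαβ) (hw _ _ hα hαβ).2.1 hWc hW hα1 ht hm k.cast_nonneg
    (S := S.toReal) ENNReal.toReal_nonneg (by
      rw [ENNReal.ofReal_toReal hSt]; exact ENNReal.ae_le_essSup _)
  -- for `S = 0` the rate is infinite, and `w(t₂) = 0`
  rcases eq_or_ne S 0 with hS0 | hS0
  · have : Im Ω m (W t₂) ≤ 0 := Im_le_of_forall_trunc hm W t₂ fun k => by
      rw [(hdecay k).1 (by simp [hS0]), mul_zero, ENNReal.ofReal_zero]
    exact this.trans zero_le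
  have hSpos : 0 < S.toReal := ENNReal.toReal_pos hS0 hSt
  set κ := 2 * (p - 1) / C * S.toReal ^ (p - 2) with hκ
  have hκ0 : 0 < κ := by positivity
  have hle : Im Ω m (W t₂) ≤
      Im Ω m (W t₁) * ENNReal.ofReal (Real.exp (-(κ * (t₂ - t₁)))) := by
    refine Im_le_of_forall_trunc hm W t₂ fun k => ?_
    refine le_trans ?_ (mul_le_mul_left (ofReal_mul_curveEnergy_le hm k.cast_nonneg W t₁) _)
    rw [← ENNReal.ofReal_mul' (Real.exp_pos _).le, mul_assoc]
    exact ENNReal.ofReal_le_ofReal (mul_le_mul_of_nonneg_left ((hdecay k).2 hSpos) hm0.le)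
  refine hle.trans ?_
  gcongr
  have hL : decayL s p u v t₁ t₂ = ENNReal.ofReal (S.toReal ^ (p - 2)) := by
    rw [decayL, ← hS, ← ENNReal.ofReal_rpow_of_pos hSpos, ENNReal.ofReal_toReal hSt]
  have hm1 : 0 ≤ (m - 1) / m := div_nonneg (by linarith) hm0.le
  have hm2 : (m - 1) / m ≤ 1 := by rw [div_le_one hm0]; linarith
  have ht' : 0 < t₂ - t₁ := sub_pos.2 ht
  rw [hL, ← ENNReal.ofReal_mul (by positivity), EReal.coe_ennreal_ofReal,
    max_eq_left (by positivity), ← EReal.coe_neg, EReal.exp_coe]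
  refine ENNReal.ofReal_le_ofReal (Real.exp_le_exp.2 (neg_le_neg ?_))
  -- the factor `(m-1)/m ≤ 1` only weakens the rate
  calc 2 * (p - 1) / C * ((m - 1) / m) * (t₂ - t₁) * S.toReal ^ (p - 2)
      = (m - 1) / m * (κ * (t₂ - t₁)) := by rw [hκ]; ring
    _ ≤ 1 * (κ * (t₂ - t₁)) := by gcongr
    _ = κ * (t₂ - t₁) := one_mul _
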